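/- Let $V$ be a one-dimensional complex vector space with a (hermitian) norm, and let $P=V\cup\{\infty\}$ be its projective compactification. For $p=1$ and $q\in\{0,1\}$ let $\mathcal Db^{1,q}$ denote distributional forms of type $(1,q)$. For an open set $U\subset V$ let $$\mathcal Db^{t,1,q}_P(U)=\{\omega\in\mathcal Db^{1,q}(U) : \omega \text{ extends to a distributional form of type }(1,q)\text{ on } P\}$$ be the space of tempered distributional forms, and let $\Omega^t_P(U)=\Omega(U)\cap\mathcal Db^{t,1,0}_P(U)$ be the space of tempered holomorphic $1$-forms. For a closed set $S\subset V$ let $\Gamma_S(V,\mathcal Db^{t,1,q}_P)$ be the space of all $T\in\mathcal Db^{t,1,q}_P(V)$ with $T|_{V\setminus S}=0$. Let $H^1_S(V,\Omega^t_P)$ be the local cohomology of the Dolbeault complex $\mathcal Db^{t,1,0}_P\xrightarrow{\bar\partial}\mathcal Db^{t,1,1}_P$, that is, the cohomology in degree $1$ of the mapping cone, shifted by $-1$, of the restriction $\mathcal Db^{t,1,\bullet}_P(V)\to\mathcal Db^{t,1,\bullet}_P(V\setminus S)$: $$H^1_S(V,\Omega^t_P)=\frac{\{(a,b)\in\mathcal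 Db^{t,1,1}_P(V)\oplus\mathcal Db^{t,1,0}_P(V\setminus S) : -a|_{V\setminus S}-\bar\partial b=0\}}{\{(\bar\partial s,\,-s|_{V\setminus S}) : s\in\mathcal Db^{t,1,0}_P(V)\}}.$$ Let $K\subset V$ be a non-empty convex compact set, let $\varepsilon>0$, and let $K_\varepsilon=K+\overline D(0,\varepsilon)=K+\{z : \|z\|\le\varepsilon\}$. Then: 1. The restriction $\Omega^t_P(V)\to\Omega^t_P(V\setminus K_\varepsilon)$ is injective, so that $\Omega^t_P(V)$ is a subspace of $\Omega^t_P(V\setminus K_\varepsilon)$. 2. There is an isomorphism of complex vector spaces $$\Psi:\ \frac{\Gamma_{K_\varepsilon}(V,\mathcal Db^{t,1,1}_P)}{\bar\partial\,\Gamma_{K_\varepsilon}(V,\mathcal Db^{t,1,0}_P)}\xrightarrow{\ \sim\ }H^1_{K_\varepsilon}(V,\Omega^t_P),\qquad [T]\mapsto[(T,0)].$$ 3. There is an isomorphism of complex vector spaces $$\Phi:\ \Omega^t_P(V\setminus K_\varepsilon)/\Omega^t_P(V)\xrightarrow{\ \sim\ }H^1_{K_\varepsilon}(V,\Omega^t_P),\qquad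 [\omega]\mapsto[(0,\omega)].$$ 4. Through the identification $\Psi$, the isomorphism $\Phi$ is given by $[\omega]\mapsto[\bar\partial\underline\omega]$: for every $\omega\in\Omega^t_P(V\setminus K_\varepsilon)$ and every $\underline\omega\in\mathcal Db^{1,0}(V)$ with $\underline\omega|_{V\setminus K_\varepsilon}=\omega$, one has $\bar\partial\underline\omega\in\Gamma_{K_\varepsilon}(V,\mathcal Db^{t,1,1}_P)$ and $\Phi([\omega])=\Psi([\bar\partial\underline\omega])$. -/

import Mathlib

open TopologicalSpace
open scoped Distributions Pointwise

noncomputable section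

/-! Throughout, `V` is meant to be a complex vector space of dimension one, with its complex
orientation.  Its projective compactification `P = V ∪ {∞}` is covered by two charts: `V` itself,
and `P \ {0}`, which is identified with the dual `V* = StrongDual ℂ V` by sending `ζ ≠ 0` to the
unique `z : V` with `ζ z = 1`, and `ζ = 0` to the point at infinity. -/

namespace TemperedForms

section Subquotients

variable {M : Type*} [AddCommGroup M] [Module ℂ M]

/-- The subquotient `Z / B` of a vector space `M`, for subspaces `Z` and `B ⊆ Z` (in general, this
is `Z / (Z ∩ B)`). -/
def Subquotient (Z B : Submodule ℂ M) : Type _ := Z ⧸ B.submoduleOf Z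

instance (Z B : Submodule ℂ M) : AddCommGroup (Subquotient Z B) :=
  inferInstanceAs (AddCommGroup (Z ⧸ B.submoduleOf Z))

instance (Z B : Submodule ℂ M) : Module ℂ (Subquotient Z B) :=
  inferInstanceAs (Module ℂ (Z ⧸ B.submoduleOf Z))

/-- The class in `Z / B` of an element `x` of `Z`. -/
def cls {Z B : Submodule ℂ M} (x : M) (hx : x ∈ Z) : Subquotient Z B :=
  (B.submoduleOf Z).mkQ ⟨x, hx⟩

end Subquotients

section Currents

variable {W : Type*} [NormedAddCommGroup W] [NormedSpace ℂ W]

/-- The continuous `ℂ`-linear functionals on the compactly supported smooth functions `U → F`. -/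
abbrev Current (U : Opens W) (F : Type*) [NormedAddCommGroup F] [NormedSpace ℂ F] : Type _ :=
  𝓓(U, F) →L[ℂ] ℂ

/-- `Db^{1,0}(U)`: distributional forms of type `(1,0)` on an open subset `U` of a complex line,
the topological dual of the compactly supported smooth forms of type `(0,1)`
(which have values in the antilinear functionals). -/
abbrev Db10 (U : Opens W) : Type _ := Current U (W →L⋆[ℂ] ℂ)

/-- `Db^{1,1}(U)`: distributional forms of type `(1,1)` on an open subset `U` of a complex line,
the topological dual of the compactly supported smooth functions. -/
abbrev Db11 (U : Opens W) : Type _ := Current U ℂ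

/-- Restriction of currents from the whole space to the open subset `U`: the transpose of the
extension by zero of test functions. -/
def restr (U : Opens W) {F : Type*} [NormedAddCommGroup F] [NormedSpace ℂ F] :
    Current (⊤ : Opens W) F →ₗ[ℂ] Current U F where
  toFun T := T ∘L (TestFunction.monoCLM ℂ : 𝓓(U, F) →L[ℂ] 𝓓((⊤ : Opens W), F))
  map_add' _ _ := rfl
  map_smul' _ _ := rfl

/-- The antilinear part `v ↦ (L v + i L (i v)) / 2` of a real-linear functional `L`. -/
def antilinearPart (L : W →L[ℝ] ℂ) : W →L⋆[ℂ] ℂ where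
  toFun v := (1 / 2 : ℂ) * (L v + Complex.I * L (Complex.I • v))
  map_add' v w := by simp only [smul_add, map_add]; ring
  map_smul' c v := by
    have key : ∀ u : W, L (c • u) = (c.re : ℂ) * L u + (c.im : ℂ) * L (Complex.I • u) := by
      intro u
      have h : c • u = c.re • u + c.im • (Complex.I • u) := by
        conv_lhs => rw [← Complex.re_add_im c]
        rw [add_smul, mul_smul]
        rfl
      rw [h, map_add, map_smul, map_smul, Complex.real_smul, Complex.real_smul]
    have hI : L (Complex.I • Complex.I • v) = - L v := by
      rw [smul_smul, Complex.I_mul_I, neg_one_smul, map_neg]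
    rw [smul_comm Complex.I c v, key v, key (Complex.I • v), hI]
    have hc : (starRingEnd ℂ) c = (c.re : ℂ) - c.im * Complex.I := by
      apply Complex.ext <;> simp
    simp only [smul_eq_mul, hc]
    linear_combination ((1 / 2 : ℂ) * c.im * L (Complex.I • v)) * Complex.I_sq
  cont := by fun_prop

/-- `antilinearPart` as a continuous linear map. -/
def antilinearPartCLM : (W →L[ℝ] ℂ) →L[ℂ] (W →L⋆[ℂ] ℂ) :=
  LinearMap.mkContinuous
    { toFun := antilinearPart
      map_add' := fun L M => by
        ext v
        simp only [antilinearPart, ContinuousLinearMap.coe_mk', LinearMap.coe_mk, AddHom.coe_mk,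
          add_apply]
        ring
      map_smul' := fun c L => by
        ext v
        simp only [antilinearPart, ContinuousLinearMap.coe_mk', LinearMap.coe_mk, AddHom.coe_mk,
          smul_apply, RingHom.id_apply, smul_eq_mul]
        ring } 1 (by
    intro L
    rw [one_mul]
    refine ContinuousLinearMap.opNorm_le_bound _ (norm_nonneg _) fun v => ?_
    change ‖(1 / 2 : ℂ) * (L v + Complex.I * L (Complex.I • v))‖ ≤ _
    have h1 := L.le_opNorm v
    have h2 := L.le_opNorm (Complex.I • v)
    rw [norm_smul, Complex.norm_I, one_mul] at h2
    have h3 := norm_add_le (L v) (Complex.I * L (Complex.I • v))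
    rw [norm_mul, Complex.norm_I, one_mul] at h3
    rw [norm_mul, show ‖(1 / 2 : ℂ)‖ = 1 / 2 by norm_num]
    linarith)

/-- `∂̄` on test functions: `∂̄φ` at `x` is the antilinear part of the differential of `φ`. -/
def dbarTest (U : Opens W) : 𝓓(U, ℂ) →L[ℂ] 𝓓(U, W →L⋆[ℂ] ℂ) :=
  TestFunction.postcompCLM antilinearPartCLM ∘L TestFunction.fderivCLM ℂ ⊤ ⊤

/-- `∂̄ : Db^{1,0}(U) → Db^{1,1}(U)`, given by `⟨∂̄T, φ⟩ = ⟨T, ∂̄φ⟩`.  The sign is the one for which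
`∂̄` extends the usual `∂̄` on smooth forms `ω` of type `(1,0)`, where `ω` is viewed as the
functional `ψ ↦ ∫ ω ∧ ψ`, since `∫ ∂̄ω · φ = ∫ ω ∧ ∂̄φ`. -/
def dbar (U : Opens W) : Db10 U →ₗ[ℂ] Db11 U where
  toFun T := T ∘L dbarTest U
  map_add' _ _ := rfl
  map_smul' _ _ := rfl

end Currents

variable {V : Type*} [NormedAddCommGroup V] [NormedSpace ℂ V]

/-- `Db^{1,0}(P)`: pairs of a distributional form on `V` and one on the chart `V*` at infinity that
correspond on the overlap, under the change of charts `z ↦ ζ`, `ζ z = 1`, from `V \ {0}` to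
`V* \ {0}`.  The differential of `z ↦ ζ` at `z` is `v ↦ -(ζ v) • ζ`, so a test form `φ` on
`V \ {0}` is the pull-back of the test form `ψ` on `V* \ {0}` iff
`φ z v = ψ ζ (-(ζ v) • ζ)` whenever `ζ z = 1`. -/
def DbP10 (V : Type*) [NormedAddCommGroup V] [NormedSpace ℂ V] :
    Submodule ℂ (Db10 (⊤ : Opens V) × Db10 (⊤ : Opens (StrongDual ℂ V))) where
  carrier := {T | ∀ (φ : 𝓓((⊤ : Opens V), V →L⋆[ℂ] ℂ))
    (ψ : 𝓓((⊤ : Opens (StrongDual ℂ V)), StrongDual ℂ V →L⋆[ℂ] ℂ)),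
    (0 : V) ∉ tsupport φ → (0 : StrongDual ℂ V) ∉ tsupport ψ →
    (∀ (z : V) (ζ : StrongDual ℂ V), ζ z = 1 → ∀ v : V, φ z v = ψ ζ (-(ζ v) • ζ)) →
    T.1 φ = T.2 ψ}
  zero_mem' := fun _ _ _ _ _ => rfl
  add_mem' := fun {S T} hS hT φ ψ h0 h1 h => by
    change S.1 φ + T.1 φ = S.2 ψ + T.2 ψ
    rw [hS φ ψ h0 h1 h, hT φ ψ h0 h1 h]
  smul_mem' := fun c T hT φ ψ h0 h1 h => by
    change c • T.1 φ = c • T.2 ψ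
    rw [hT φ ψ h0 h1 h]

/-- `Db^{1,1}(P)`: pairs of a distributional form on `V` and one on the chart `V*` at infinity that
correspond on the overlap under the change of charts `z ↦ ζ`, `ζ z = 1`. -/
def DbP11 (V : Type*) [NormedAddCommGroup V] [NormedSpace ℂ V] :
    Submodule ℂ (Db11 (⊤ : Opens V) × Db11 (⊤ : Opens (StrongDual ℂ V))) where
  carrier := {T | ∀ (φ : 𝓓((⊤ : Opens V), ℂ)) (ψ : 𝓓((⊤ : Opens (StrongDual ℂ V)), ℂ)),
    (0 : V) ∉ tsupport φ → (0 : StrongDual ℂ V) ∉ tsupport ψ →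
    (∀ (z : V) (ζ : StrongDual ℂ V), ζ z = 1 → φ z = ψ ζ) →
    T.1 φ = T.2 ψ}
  zero_mem' := fun _ _ _ _ _ => rfl
  add_mem' := fun {S T} hS hT φ ψ h0 h1 h => by
    change S.1 φ + T.1 φ = S.2 ψ + T.2 ψ
    rw [hS φ ψ h0 h1 h, hT φ ψ h0 h1 h]
  smul_mem' := fun c T hT φ ψ h0 h1 h => by
    change c • T.1 φ = c • T.2 ψ
    rw [hT φ ψ h0 h1 h]

/-- `Db^{t,1,0}_P(U)` for `U ⊆ V` open: the distributional forms on `U` that extend to `P`. -/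
def DbT10 (U : Opens V) : Submodule ℂ (Db10 U) :=
  (DbP10 V).map (restr U ∘ₗ LinearMap.fst ℂ _ _)

/-- `Db^{t,1,1}_P(U)` for `U ⊆ V` open: the distributional forms on `U` that extend to `P`. -/
def DbT11 (U : Opens V) : Submodule ℂ (Db11 U) :=
  (DbP11 V).map (restr U ∘ₗ LinearMap.fst ℂ _ _)

/-- `T` is the functional `ψ ↦ ∫_U f ∧ ψ` defined by the `(1,0)`-form `f` on `U`.  In the linear
coordinate `w` with base vector `b ≠ 0` one has `f = f(b) dw`, `ψ = ψ(b) dw̄` and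
`dw ∧ dw̄ = -2i dx ∧ dy`.  All nonzero `b` give the same integral. -/
def IsGivenBy (U : Opens V) (T : Db10 U) (f : V → StrongDual ℂ V) : Prop :=
  ∀ b : V, b ≠ 0 → ∀ ψ : 𝓓(U, V →L⋆[ℂ] ℂ),
    T ψ = ∫ w : ℂ, (-2 * Complex.I) * (f (w • b) b * ψ (w • b) b)

/-- The integrand in `IsGivenBy` is integrable when `f` is holomorphic on `U`. -/
theorem integrable_aux {U : Opens V} {f : V → StrongDual ℂ V} (hf : DifferentiableOn ℂ f U)
    {b : V} (hb : b ≠ 0) (ψ : 𝓓(U, V →L⋆[ℂ] ℂ)) :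
    MeasureTheory.Integrable
      (fun w : ℂ => (-2 * Complex.I) * (f (w • b) b * ψ (w • b) b)) := by
  have hb' : Continuous fun w : ℂ => w • b := by fun_prop
  have hcs : HasCompactSupport (fun w : ℂ => ψ (w • b) b) := by
    have h1 : HasCompactSupport (fun w : ℂ => ψ (w • b)) :=
      ψ.hasCompactSupport.comp_isClosedEmbedding (isClosedEmbedding_smul_left hb)
    exact h1.comp_left (g := fun L : V →L⋆[ℂ] ℂ => L b) rfl
  refine Continuous.integrable_of_hasCompactSupport ?_ (hcs.mul_left.mul_left)
  refine continuous_const.mul (continuous_iff_continuousAt.2 fun w => ?_)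
  by_cases hw : w • b ∈ tsupport ψ
  · have hU : w • b ∈ (U : Set V) := ψ.tsupport_subset hw
    have h1 : ContinuousAt f (w • b) := hf.continuousOn.continuousAt (U.isOpen.mem_nhds hU)
    have h2 : ContinuousAt (fun w : ℂ => f (w • b)) w :=
      ContinuousAt.comp (f := fun w : ℂ => w • b) h1 hb'.continuousAt
    have h3 : ContinuousAt (fun w : ℂ => ψ (w • b)) w :=
      (ψ.continuous.comp hb').continuousAt
    exact (h2.clm_apply continuousAt_const).mul
      (((ContinuousLinearMap.apply' ℂ (starRingEnd ℂ) b).continuous).continuousAt.comp h3)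
  · have h1 : ∀ᶠ x in nhds (w • b), ψ x = 0 := by
      have := notMem_tsupport_iff_eventuallyEq.1 hw
      exact this
    have h2 : (fun w : ℂ => f (w • b) b * ψ (w • b) b) =ᶠ[nhds w] fun _ => 0 := by
      filter_upwards [hb'.continuousAt.eventually h1] with x hx
      rw [hx]
      simp
    exact continuousAt_const.congr h2.symm

/-- `Ω(U)`: the holomorphic forms of degree one on `U`, as a subspace of `Db^{1,0}(U)`. -/
def Omega (U : Opens V) : Submodule ℂ (Db10 U) where
  carrier := {T | ∃ f : V → StrongDual ℂ V, DifferentiableOn ℂ f U ∧ IsGivenBy U T f}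
  zero_mem' := ⟨0, differentiableOn_const 0, fun b _ ψ => by simp⟩
  add_mem' := by
    rintro S T ⟨f, hf, hS⟩ ⟨g, hg, hT⟩
    refine ⟨f + g, hf.add hg, fun b hb ψ => ?_⟩
    have h := MeasureTheory.integral_add (integrable_aux hf hb ψ) (integrable_aux hg hb ψ)
    rw [add_apply, hS b hb ψ, hT b hb ψ, ← h]
    congr 1
    ext w
    simp only [Pi.add_apply, add_apply]
    ring
  smul_mem' := by
    rintro c T ⟨f, hf, hT⟩
    refine ⟨c • f, hf.const_smul c, fun b hb ψ => ?_⟩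
    rw [smul_apply, hT b hb ψ, ← MeasureTheory.integral_smul]
    congr 1
    ext w
    simp only [Pi.smul_apply, smul_apply, smul_eq_mul]
    ring

/-- `Ω^t_P(U) = Ω(U) ∩ Db^{t,1,0}_P(U)` for `U ⊆ V` open. -/
def OmegaT (U : Opens V) : Submodule ℂ (Db10 U) := Omega U ⊓ DbT10 U

/-- `Ω^t_P(U) / Ω^t_P(V)`, the cokernel of the restriction map. -/
abbrev OmegaQuot (U : Opens V) : Type _ :=
  Subquotient (OmegaT U) ((OmegaT (⊤ : Opens V)).map (restr U))

/-- `Γ(V, IΓ_S(Db^{t,1,0}_P))` for the closed set `S = V \ U`: the sections over `V` that vanish on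
`V \ S`. -/
def Gamma10 (U : Opens V) : Submodule ℂ (Db10 (⊤ : Opens V)) :=
  DbT10 ⊤ ⊓ LinearMap.ker (restr U)

/-- `Γ(V, IΓ_S(Db^{t,1,1}_P))` for the closed set `S = V \ U`: the sections over `V` that vanish on
`V \ S`. -/
def Gamma11 (U : Opens V) : Submodule ℂ (Db11 (⊤ : Opens V)) :=
  DbT11 ⊤ ⊓ LinearMap.ker (restr U)

/-- `Γ(V, IΓ_S(Db^{t,1,1}_P)) / ∂̄ Γ(V, IΓ_S(Db^{t,1,0}_P))`, where `S = V \ U`. -/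
abbrev GammaQuot (U : Opens V) : Type _ :=
  Subquotient (Gamma11 U) ((Gamma10 U).map (dbar ⊤))

/-! ### Local cohomology

`RΓ(V, IΓ_S(Ω^t_P))`, for `S = V \ U`, is the third vertex of the excision triangle
`RΓ(V, IΓ_S(Ω^t_P)) → RΓ(V, Ω^t_P) → RΓ(U, Ω^t_P) → +1`.  As `Ω^t_P` is the Dolbeault complex
`Db^{t,1,0}_P → Db^{t,1,1}_P`, whose terms are acyclic for sections, it is the mapping cone, shifted
by `-1`, of the restriction `Db^{t,1,•}_P(V) → Db^{t,1,•}_P(U)`, that is, the complex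
`Db^{t,1,0}_P(V) → Db^{t,1,1}_P(V) ⊕ Db^{t,1,0}_P(U) → Db^{t,1,1}_P(U)` in degrees `0`, `1`, `2`. -/

/-- The differential `S ↦ (∂̄S, -S|_U)` in degree `0`. -/
def coneD0 (U : Opens V) :
    Db10 (⊤ : Opens V) →ₗ[ℂ] Db11 (⊤ : Opens V) × Db10 U :=
  (dbar ⊤).prod (-restr U)

/-- The differential `(a, b) ↦ -a|_U - ∂̄b` in degree `1`. -/
def coneD1 (U : Opens V) :
    Db11 (⊤ : Opens V) × Db10 U →ₗ[ℂ] Db11 U :=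
  (-restr U).coprod (-dbar U)

/-- The `1`-cocycles. -/
def cocycles (U : Opens V) : Submodule ℂ (Db11 (⊤ : Opens V) × Db10 U) :=
  (DbT11 (⊤ : Opens V)).prod (DbT10 U) ⊓ LinearMap.ker (coneD1 U)

/-- The `1`-coboundaries. -/
def coboundaries (U : Opens V) : Submodule ℂ (Db11 (⊤ : Opens V) × Db10 U) :=
  (DbT10 (⊤ : Opens V)).map (coneD0 U)

/-- `H^1_S(V, Ω^t_P)`, where `S = V \ U`. -/
abbrev LocalH1 (U : Opens V) : Type _ :=
  Subquotient (cocycles U) (coboundaries U)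

/-- The open set `V \ K_ε`, where `K_ε = K + D̄(0,ε)` and `K` is compact. -/
def complThickening {K : Set V} (hK : IsCompact K) (ε : ℝ) : Opens V :=
  ⟨(K + Metric.closedBall (0 : V) ε)ᶜ,
    (Metric.isClosed_closedBall.add_left_of_isCompact hK).isOpen_compl⟩

/-! ### The subquotients above are well formed

`∂̄` and the restrictions preserve the tempered forms, so that in each of the three subquotients the
denominator is contained in the numerator. -/

theorem monoCLM_apply_apply {W : Type*} [NormedAddCommGroup W] [NormedSpace ℂ W] (U : Opens W) {F : Type*}
    [NormedAddCommGroup F] [NormedSpace ℂ F] (φ : 𝓓(U, F)) (z : W) :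
    (TestFunction.monoCLM ℂ φ : 𝓓((⊤ : Opens W), F)) z = φ z := by
  rw [TestFunction.monoCLM_apply, if_pos ⟨le_rfl, le_top⟩]

theorem restr_apply {W : Type*} [NormedAddCommGroup W] [NormedSpace ℂ W] (U : Opens W) {F : Type*}
    [NormedAddCommGroup F] [NormedSpace ℂ F] (T : Current (⊤ : Opens W) F) (φ : 𝓓(U, F)) :
    restr U T φ = T (TestFunction.monoCLM ℂ φ) :=
  rfl

theorem dbarTest_apply {W : Type*} [NormedAddCommGroup W] [NormedSpace ℂ W] (U : Opens W)
    (φ : 𝓓(U, ℂ)) (z v : W) :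
    dbarTest U φ z v =
      (1 / 2 : ℂ) * (fderiv ℝ φ z v + Complex.I * fderiv ℝ φ z (Complex.I • v)) := by
  have h : (TestFunction.fderivCLM ℂ ⊤ ⊤ φ : 𝓓(U, W →L[ℝ] ℂ)) z = fderiv ℝ φ z := by
    rw [TestFunction.fderivCLM_apply_of_le φ (by simp)]
  rw [← h]
  rfl

theorem tsupport_dbarTest_subset {W : Type*} [NormedAddCommGroup W] [NormedSpace ℂ W] (U : Opens W)
    (φ : 𝓓(U, ℂ)) : tsupport (dbarTest U φ) ⊆ tsupport φ := by
  refine (closure_mono fun x hx => ?_).trans (tsupport_fderiv_subset ℝ (f := φ))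
  rw [Function.mem_support] at hx ⊢
  intro h0
  refine hx ?_
  ext v
  rw [dbarTest_apply, h0]
  simp

theorem dbar_restr {W : Type*} [NormedAddCommGroup W] [NormedSpace ℂ W] (U : Opens W)
    (T : Db10 (⊤ : Opens W)) : dbar U (restr U T) = restr U (dbar ⊤ T) := by
  ext φ
  change T (TestFunction.monoCLM ℂ (dbarTest U φ)) =
    T (dbarTest ⊤ (TestFunction.monoCLM ℂ φ))
  congr 1
  ext z v
  have h : ((TestFunction.monoCLM ℂ φ : 𝓓((⊤ : Opens W), ℂ)) : W → ℂ) = φ :=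
    funext (monoCLM_apply_apply U φ)
  refine (congrArg (fun L : W →L⋆[ℂ] ℂ => L v) (monoCLM_apply_apply U (dbarTest U φ) z)).trans ?_
  refine (dbarTest_apply U φ z v).trans (Eq.trans ?_ (dbarTest_apply ⊤ _ z v).symm)
  rw [h]

/-- `∂̄` is compatible with the change of charts, hence acts on forms on `P`. -/
theorem dbar_mem_DbP11 {T : Db10 (⊤ : Opens V) × Db10 (⊤ : Opens (StrongDual ℂ V))}
    (hT : T ∈ DbP10 V) : (dbar ⊤ T.1, dbar ⊤ T.2) ∈ DbP11 V := by
  intro φ ψ h0 h1 h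
  change T.1 (dbarTest ⊤ φ) = T.2 (dbarTest ⊤ ψ)
  refine hT _ _ (fun h' => h0 (tsupport_dbarTest_subset _ _ h'))
    (fun h' => h1 (tsupport_dbarTest_subset _ _ h')) fun z ζ hz v => ?_
  have key : ∀ u : V, fderiv ℝ φ z u = fderiv ℝ ψ ζ (-(ζ u) • ζ) := by
    intro u
    have hζ : HasFDerivAt (fun y : V => ζ y) (ζ.restrictScalars ℝ) z :=
      (ζ.restrictScalars ℝ).hasFDerivAt
    have hne : ζ z ≠ 0 := by rw [hz]; exact one_ne_zero
    have hinv := ((hasDerivAt_inv hne).hasFDerivAt.restrictScalars ℝ).comp z hζ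
    have hsm := hinv.smul_const ζ
    have hψ : HasFDerivAt ψ (fderiv ℝ ψ ζ) ((ζ z)⁻¹ • ζ) := by
      rw [hz, inv_one, one_smul]
      exact (ψ.contDiff.differentiable (by simp)).differentiableAt.hasFDerivAt
    have hcomp := HasFDerivAt.comp z hψ hsm
    have heq : (φ : V → ℂ) =ᶠ[nhds z] (ψ ∘ fun y : V => (ζ y)⁻¹ • ζ) := by
      filter_upwards [ζ.continuous.continuousAt.eventually_ne hne] with y hy
      exact h y _ (by simp [hy])
    rw [(hcomp.congr_of_eventuallyEq heq).fderiv]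
    simp [hz, ← map_neg]
  rw [dbarTest_apply, dbarTest_apply, key v, key (Complex.I • v)]
  congr 4
  rw [map_smul, smul_smul, smul_eq_mul, mul_neg]

theorem restr_mem_DbT10 {U : Opens V} {T : Db10 (⊤ : Opens V)} (hT : T ∈ DbT10 ⊤) :
    restr U T ∈ DbT10 U := by
  obtain ⟨S, hS, rfl⟩ := hT
  refine ⟨S, hS, ?_⟩
  ext φ
  change S.1 (TestFunction.monoCLM ℂ φ) =
    S.1 (TestFunction.monoCLM ℂ (TestFunction.monoCLM ℂ φ : 𝓓((⊤ : Opens V), V →L⋆[ℂ] ℂ)))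
  congr 1
  ext z : 1
  exact (monoCLM_apply_apply ⊤ _ z).symm

theorem dbar_mem_DbT11 {U : Opens V} {T : Db10 U} (hT : T ∈ DbT10 U) : dbar U T ∈ DbT11 U := by
  obtain ⟨S, hS, rfl⟩ := hT
  exact ⟨_, dbar_mem_DbP11 hS, (dbar_restr U S.1).symm⟩

theorem restr_mem_Omega {U : Opens V} {T : Db10 (⊤ : Opens V)} (hT : T ∈ Omega ⊤) :
    restr U T ∈ Omega U := by
  obtain ⟨f, hf, hT⟩ := hT
  refine ⟨f, hf.mono (Set.subset_univ _), fun b hb ψ => ?_⟩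
  refine (hT b hb _).trans ?_
  congr 1
  ext w
  congr 2
  exact congrArg (fun L : V →L⋆[ℂ] ℂ => L b) (monoCLM_apply_apply U ψ (w • b))

theorem map_restr_le (U : Opens V) : (OmegaT (⊤ : Opens V)).map (restr U) ≤ OmegaT U := by
  rintro _ ⟨T, hT, rfl⟩
  exact ⟨restr_mem_Omega hT.1, restr_mem_DbT10 hT.2⟩

theorem map_dbar_le (U : Opens V) : (Gamma10 U).map (dbar ⊤) ≤ Gamma11 U := by
  rintro _ ⟨T, hT, rfl⟩
  refine ⟨dbar_mem_DbT11 hT.1, ?_⟩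
  change restr U (dbar ⊤ T) = 0
  have h : restr U T = 0 := hT.2
  rw [← dbar_restr, h, map_zero]

theorem coboundaries_le (U : Opens V) : coboundaries U ≤ cocycles U := by
  rintro _ ⟨T, hT, rfl⟩
  refine ⟨⟨dbar_mem_DbT11 hT, (DbT10 U).neg_mem (restr_mem_DbT10 hT)⟩, ?_⟩
  change -(restr U (dbar ⊤ T)) + -(dbar U (-(restr U T))) = 0
  rw [map_neg, dbar_restr, neg_neg, neg_add_cancel]

end TemperedForms

end

/-! Write U for the complement of K_ε, so that V \ U is compact. A tempered form on U is the
restriction of a form on P, hence of a tempered form on V. So a cocycle (a, b) with b = s|_U is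
cohomologous to (a + ∂̄s, 0), and a + ∂̄s vanishes on U. This gives Ψ (`exists_gammaEquiv`) by pure
algebra.

For Φ (`exists_omegaEquiv`), (0, ω) is a cocycle because ∂̄ kills holomorphic forms. Injectivity: if
(0, ω) is the coboundary of s, then ∂̄s = 0, so s is holomorphic on V by Weyl's lemma
(`mem_Omega_of_dbar_eq_zero`) and ω is the restriction of -s. Surjectivity: extend b to a tempered r
on V. The form a + ∂̄r is supported in a compact set, so it equals ∂̄s with s tempered
(`exists_dbar_eq`). Then (a, b) is cohomologous to (0, s|_U), and s|_U is holomorphic, again by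
Weyl's lemma.

Both analytic inputs come from one parametrix (`exists_parametrix`). Cutting off the Cauchy kernel
1/(πz) near the origin gives κ with κ * ∂̄ψ = ψ - g * ψ, where g is smooth and both κ and g have
small support. If ∂̄T = 0, then T ψ = T (g * ψ), and this is integration of ψ against the function w
↦ T (g(· - w)). If a has compact support, then ψ ↦ a (κ * ψ) is a compactly supported primitive of a
up to a continuous compactly supported function, and the Cauchy transform of that function is
O(1/|w|). Both pieces extend across infinity: the first by zero (`mem_DbT10_of_compact_support`),
the second because h dw with h = O(1/|w|) becomes O(1/|ζ|) dζ in the coordinate ζ = 1/w, which is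
locally integrable (`mem_DbT10_of_norm_mul_le`).

The formula ω ↦ ∂̄S holds since two extensions of ω differ by a compactly supported current, so that
every extension S is tempered, and the coboundary of -S is (0, ω) - (∂̄S, 0). The injectivity of the
restriction is the identity theorem. -/

noncomputable section

namespace TemperedForms

/-! ### Continuous operators between spaces of test functions -/

section TestFunctionOperators

variable {E E' F G : Type*} [NormedAddCommGroup E] [NormedSpace ℝ E]
  [NormedAddCommGroup E'] [NormedSpace ℝ E']
  [NormedAddCommGroup F] [NormedSpace ℂ F] [NormedAddCommGroup G] [NormedSpace ℂ G]

/-- A linear operator on test functions that maps functions supported in a compact set to functions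
supported in a compact set, with control on the derivatives, is continuous. -/
theorem exists_testFunctionCLM {Ω : Opens E} {U : Opens E'} (A : 𝓓(Ω, F) → E' → G)
    (hadd : ∀ f g x, A (f + g) x = A f x + A g x)
    (hsmul : ∀ (c : ℂ) f x, A (c • f) x = c • A f x)
    (h : ∀ K : Compacts E, (K : Set E) ⊆ Ω → ∃ L : Compacts E', (L : Set E') ⊆ U ∧
      (∀ f : 𝓓(Ω, F), tsupport f ⊆ K → ContDiff ℝ (⊤ : ℕ∞) (A f) ∧ Set.EqOn (A f) 0 Lᶜ) ∧
      ∀ i : ℕ, ∃ C : ℝ, 0 ≤ C ∧ ∀ f : 𝓓(Ω, F), tsupport f ⊆ K → ∀ M : ℝ,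
        (∀ j ≤ i, ∀ x, ‖iteratedFDeriv ℝ j f x‖ ≤ M) →
          ∀ x ∈ L, ‖iteratedFDeriv ℝ i (A f) x‖ ≤ C * M) :
    ∃ B : 𝓓(Ω, F) →L[ℂ] 𝓓(U, G), ∀ f x, B f x = A f x := by
  choose L hLU hL hC using h
  have hts : ∀ {K : Compacts E} (hK : (K : Set E) ⊆ Ω) (f : 𝓓_{K}(E, F)),
      tsupport (TestFunction.ofSupportedIn hK f) ⊆ K := fun hK f => f.tsupport_subset
  have hself : ∀ f : 𝓓(Ω, F), ContDiff ℝ (⊤ : ℕ∞) (A f) ∧ HasCompactSupport (A f) ∧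
      tsupport (A f) ⊆ U := by
    intro f
    let K : Compacts E := ⟨tsupport f, f.hasCompactSupport⟩
    have hK : (K : Set E) ⊆ Ω := f.tsupport_subset
    have h1 := hL K hK f subset_rfl
    refine ⟨h1.1, .intro (L K hK).isCompact h1.2, ?_⟩
    refine (closure_minimal ?_ (L K hK).isCompact.isClosed).trans (hLU K hK)
    exact Function.support_subset_iff'.2 h1.2
  -- Continuity on the inductive limit is tested on each space of functions supported in a fixed
  -- compact set, where it is a seminorm estimate.
  have hT : ∀ (K : Compacts E) (hK : (K : Set E) ⊆ Ω), ∃ T : 𝓓_{K}(E, F) →L[ℂ] 𝓓(U, G),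
      ∀ f x, T f x = A (TestFunction.ofSupportedIn hK f) x := by
    intro K hK
    have key : ∃ T : 𝓓_{K}(E, F) →L[ℂ] 𝓓_{L K hK}(E', G),
        ∀ f x, T f x = A (TestFunction.ofSupportedIn hK f) x := by
      have hbd : ∀ i : ℕ, (i : ℕ∞) ≤ ⊤ → ∃ (s : Finset ℕ) (C : ℝ), 0 ≤ C ∧ ∀ f : 𝓓_{K}(E, F),
          ∀ x ∈ L K hK, ‖iteratedFDeriv ℝ i (A (TestFunction.ofSupportedIn hK f)) x‖ ≤
            C * (s.sup fun j => ContDiffMapSupportedIn.seminorm ℂ E F ⊤ K j) f := by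
        intro i _
        obtain ⟨C, hC0, hC⟩ := hC K hK i
        refine ⟨Finset.range (i + 1), C, hC0, fun f x hx => ?_⟩
        refine hC _ (hts hK f) _ (fun j hj y => ?_) x hx
        refine (ContDiffMapSupportedIn.norm_iteratedFDeriv_apply_le_seminorm_top ℂ).trans ?_
        exact Seminorm.le_finset_sup_apply (Finset.mem_range.2 (Nat.lt_succ_of_le hj))
      let Φ : 𝓓_{K}(E, F) →ₗ[ℂ] 𝓓_{L K hK}(E', G) :=
        { toFun f := ⟨A (TestFunction.ofSupportedIn hK f), (hL K hK _ (hts hK f)).1,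
            (hL K hK _ (hts hK f)).2⟩
          map_add' f g := ContDiffMapSupportedIn.ext fun x =>
            hadd (TestFunction.ofSupportedIn hK f) (TestFunction.ofSupportedIn hK g) x
          map_smul' c f := ContDiffMapSupportedIn.ext fun x =>
            hsmul c (TestFunction.ofSupportedIn hK f) x }
      have hΦ : Continuous Φ := by
        refine WithSeminorms.continuous_of_isBounded (ContDiffMapSupportedIn.withSeminorms ..)
          (ContDiffMapSupportedIn.withSeminorms ..) _ (.of_real fun i => ?_)
        obtain ⟨s, C, hC, h⟩ := hbd i le_top
        exact ⟨s, C, fun f => ((Φ f).seminorm_le_iff ℂ (mul_nonneg hC (apply_nonneg _ _)) i).2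
          fun _ x hx => h f x hx⟩
      exact ⟨⟨Φ, hΦ⟩, fun f x => rfl⟩
    obtain ⟨T, hT⟩ := key
    exact ⟨TestFunction.ofSupportedInCLM ℂ (hLU K hK) ∘L T, hT⟩
  choose T hT using hT
  let B : 𝓓(Ω, F) → 𝓓(U, G) := fun f => ⟨A f, (hself f).1, (hself f).2.1, (hself f).2.2⟩
  have hB : ∀ K hK (f : 𝓓_{K}(E, F)), B (TestFunction.ofSupportedIn hK f) = T K hK f :=
    fun K hK f => TestFunction.ext fun x => (hT K hK f x).symm
  exact ⟨TestFunction.limitCLM ℂ B T hB, fun f x => rfl⟩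

/-- Pull-back of test functions along `σ`, followed by multiplication by `ρ`. -/
theorem exists_pullbackCLM {Ω : Opens E} {U : Opens E'} (ρ : E' → ℂ) (σ : E' → E)
    (h : ∀ K : Set E, IsCompact K → K ⊆ Ω → ∃ L : Set E', IsCompact L ∧ L ⊆ U ∧
      (∃ O : Set E', IsOpen O ∧ L ⊆ O ∧ ContDiffOn ℝ (⊤ : ℕ∞) ρ O ∧ ContDiffOn ℝ (⊤ : ℕ∞) σ O) ∧
      ∀ z, ρ z ≠ 0 → σ z ∈ K → z ∈ L) :
    ∃ B : 𝓓(Ω, F) →L[ℂ] 𝓓(U, F), ∀ f z, B f z = ρ z • f (σ z) := by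
  refine exists_testFunctionCLM (fun f z => ρ z • f (σ z)) (fun f g x => smul_add _ _ _)
    (fun c f x => smul_comm _ _ _) fun K hK => ?_
  obtain ⟨L, hLc, hLU, ⟨O, hO, hLO, hρ, hσ⟩, hL⟩ := h K K.isCompact hK
  have hzero : ∀ f : 𝓓(Ω, F), tsupport f ⊆ K → ∀ z, z ∉ L → ρ z • f (σ z) = 0 := by
    intro f hf z hz
    by_cases h1 : ρ z = 0
    · rw [h1, zero_smul]
    · have : σ z ∉ tsupport f := fun h2 => hz (hL z h1 (hf h2))
      rw [image_eq_zero_of_notMem_tsupport this, smul_zero]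
  have hsm : ∀ f : 𝓓(Ω, F), ContDiffOn ℝ (⊤ : ℕ∞) (fun z => ρ z • f (σ z)) O := fun f =>
    hρ.smul (f.contDiff.comp_contDiffOn hσ)
  refine ⟨⟨L, hLc⟩, hLU, fun f hf => ⟨?_, fun z hz => hzero f hf z hz⟩, fun i => ?_⟩
  · rw [contDiff_iff_contDiffAt]
    intro z
    -- Smoothness of ρ and σ is only given on O, but a point outside O has a neighbourhood disjoint
    -- from the closed set L, where the product vanishes.
    by_cases hz : z ∈ O
    · exact (hsm f).contDiffAt (hO.mem_nhds hz)
    · have h1 : ∀ᶠ y in nhds z, y ∉ L := hLc.isClosed.isOpen_compl.mem_nhds fun h => hz (hLO h)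
      refine contDiffAt_const (c := (0 : F)) |>.congr_of_eventuallyEq ?_
      filter_upwards [h1] with y hy using hzero f hf y hy
  · have hbdρ : ∀ j : ℕ, ∃ C : ℝ, 0 ≤ C ∧ ∀ x ∈ L, ‖iteratedFDerivWithin ℝ j ρ O x‖ ≤ C := by
      intro j
      have hc := (hρ.continuousOn_iteratedFDerivWithin (m := j) (mod_cast le_top)
        hO.uniqueDiffOn).mono hLO
      obtain ⟨C, hC⟩ := hLc.exists_bound_of_continuousOn hc
      exact ⟨max C 0, le_max_right _ _, fun x hx => (hC x hx).trans (le_max_left _ _)⟩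
    have hbdσ : ∀ j : ℕ, ∃ C : ℝ, 0 ≤ C ∧ ∀ x ∈ L, ‖iteratedFDerivWithin ℝ j σ O x‖ ≤ C := by
      intro j
      have hc := (hσ.continuousOn_iteratedFDerivWithin (m := j) (mod_cast le_top)
        hO.uniqueDiffOn).mono hLO
      obtain ⟨C, hC⟩ := hLc.exists_bound_of_continuousOn hc
      exact ⟨max C 0, le_max_right _ _, fun x hx => (hC x hx).trans (le_max_left _ _)⟩
    choose R hR0 hR using hbdρ
    choose S hS0 hS using hbdσ
    -- The summand 1 makes D ≥ 1, so D ≤ D ^ l for l ≥ 1: the bound on the l-th derivative of the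
    -- inner function has to be of the form D ^ l.
    set D : ℝ := 1 + ∑ j ∈ Finset.range (i + 1), S j with hD
    have hD1 : 1 ≤ D := le_add_of_nonneg_right (Finset.sum_nonneg fun j _ => hS0 j)
    have hD0 : 0 ≤ D := zero_le_one.trans hD1
    refine ⟨∑ j ∈ Finset.range (i + 1), (i.choose j : ℝ) * R j *
      (((i - j).factorial : ℝ) * D ^ (i - j)), Finset.sum_nonneg fun j _ => ?_, ?_⟩
    · have := hR0 j
      positivity
    intro f hf M hM x hx
    have hle : ∀ n : ℕ, (n : WithTop ℕ∞) ≤ ((⊤ : ℕ∞) : WithTop ℕ∞) := fun n => mod_cast le_top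
    have hxO := hLO hx
    rw [← iteratedFDerivWithin_of_isOpen i hO hxO]
    refine (norm_iteratedFDerivWithin_smul_le (n := i) hρ (f.contDiff.comp_contDiffOn hσ)
      hO.uniqueDiffOn hxO (mod_cast le_top)).trans ?_
    rw [Finset.sum_mul]
    refine Finset.sum_le_sum fun j hj => ?_
    have hj' := Finset.mem_range.1 hj
    have hcomp : ‖iteratedFDerivWithin ℝ (i - j) (f ∘ σ) O x‖ ≤
        ((i - j).factorial : ℝ) * M * D ^ (i - j) := by
      refine norm_iteratedFDerivWithin_comp_le (N := ((⊤ : ℕ∞) : WithTop ℕ∞)) (t := Set.univ) f.contDiff.contDiffOn hσ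
        (hle _) uniqueDiffOn_univ hO.uniqueDiffOn (Set.mapsTo_univ _ _) hxO ?_ ?_
      · intro l hl
        rw [iteratedFDerivWithin_univ]
        exact hM l (by omega) _
      · intro l hl1 hl
        calc _ ≤ S l := hS l x hx
          _ ≤ D := (Finset.single_le_sum (f := S) (fun j _ => hS0 j)
              (Finset.mem_range.2 (show l < i + 1 by omega))).trans (by rw [hD]; linarith)
          _ ≤ D ^ l := le_self_pow₀ hD1 (by omega)
    calc _ ≤ (i.choose j : ℝ) * R j * (((i - j).factorial : ℝ) * M * D ^ (i - j)) := by
            gcongr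
            · exact mul_nonneg (Nat.cast_nonneg _) (hR0 j)
            · exact hR j x hx
      _ = _ := by ring

/-- Pull-back of test functions along `σ`, followed by multiplication by `ρ` and composition with a
linear map of the values. -/
theorem exists_pullback_postcompCLM {Ω : Opens E} {U : Opens E'} (ρ : E' → ℂ) (σ : E' → E)
    (A : F →L[ℂ] G)
    (h : ∀ K : Set E, IsCompact K → K ⊆ Ω → ∃ L : Set E', IsCompact L ∧ L ⊆ U ∧
      (∃ O : Set E', IsOpen O ∧ L ⊆ O ∧ ContDiffOn ℝ (⊤ : ℕ∞) ρ O ∧ ContDiffOn ℝ (⊤ : ℕ∞) σ O) ∧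
      ∀ z, ρ z ≠ 0 → σ z ∈ K → z ∈ L) :
    ∃ B : 𝓓(Ω, F) →L[ℂ] 𝓓(U, G), ∀ f z, B f z = ρ z • A (f (σ z)) := by
  obtain ⟨B, hB⟩ := exists_pullbackCLM (F := F) ρ σ h
  refine ⟨TestFunction.postcompCLM A ∘L B, fun f z => ?_⟩
  change A (B f z) = _
  rw [hB, map_smul]

end TestFunctionOperators

/-! ### The Cauchy-Pompeiu formula and Stokes' theorem in the plane -/

section CauchyPompeiu

open MeasureTheory Complex

/-- The Wirtinger derivative `∂u/∂z̄`. -/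
def wirtingerBar (u : ℂ → ℂ) (z : ℂ) : ℂ :=
  (1 / 2 : ℂ) * (fderiv ℝ u z 1 + I * fderiv ℝ u z I)

/-- The Cauchy kernel `1 / (π z)`. -/
def cauchyKernel (z : ℂ) : ℂ := ((Real.pi : ℂ) * z)⁻¹

theorem fderiv_complex_apply (L : ℂ →L[ℝ] ℂ) (z : ℂ) : L z = z.re * L 1 + z.im * L I := by
  conv_lhs => rw [show z = z.re • (1 : ℂ) + z.im • I by simp]
  rw [map_add, map_smul, map_smul, real_smul, real_smul]

theorem contDiff_wirtingerBar {u : ℂ → ℂ} (hu : ContDiff ℝ (⊤ : ℕ∞) u) :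
    ContDiff ℝ (⊤ : ℕ∞) (wirtingerBar u) := by
  have h1 : ContDiff ℝ (⊤ : ℕ∞) (fderiv ℝ u) := hu.fderiv_right (by simp)
  exact contDiff_const.mul ((h1.clm_apply contDiff_const).add
    (contDiff_const.mul (h1.clm_apply contDiff_const)))

theorem continuous_wirtingerBar {u : ℂ → ℂ} (hu : ContDiff ℝ 1 u) :
    Continuous (wirtingerBar u) := by
  have h1 := hu.continuous_fderiv one_ne_zero
  unfold wirtingerBar
  fun_prop

theorem tsupport_wirtingerBar_subset (u : ℂ → ℂ) : tsupport (wirtingerBar u) ⊆ tsupport u := by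
  refine (closure_mono fun z hz => ?_).trans (tsupport_fderiv_subset ℝ (f := u))
  intro h0
  exact hz (by simp [wirtingerBar, h0])

theorem hasCompactSupport_wirtingerBar {u : ℂ → ℂ} (hu : HasCompactSupport u) :
    HasCompactSupport (wirtingerBar u) :=
  hu.mono' ((subset_tsupport _).trans (tsupport_wirtingerBar_subset u))

theorem wirtingerBar_mul {u v : ℂ → ℂ} {z : ℂ} (hu : DifferentiableAt ℝ u z)
    (hv : DifferentiableAt ℝ v z) :
    wirtingerBar (fun w => u w * v w) z = wirtingerBar u z * v z + u z * wirtingerBar v z := by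
  have h := (hu.hasFDerivAt.mul hv.hasFDerivAt).fderiv
  have h' : fderiv ℝ (fun w => u w * v w) z = u z • fderiv ℝ v z + v z • fderiv ℝ u z := h
  simp only [wirtingerBar, h', add_apply, smul_apply, smul_eq_mul]
  ring

theorem wirtingerBar_of_differentiableAt {u : ℂ → ℂ} {z : ℂ} (hu : DifferentiableAt ℂ u z) :
    wirtingerBar u z = 0 := by
  have h : fderiv ℝ u z = (fderiv ℂ u z).restrictScalars ℝ :=
    (hu.hasFDerivAt.restrictScalars ℝ).fderiv
  have h2 : fderiv ℂ u z I = I * fderiv ℂ u z 1 := by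
    rw [← smul_eq_mul, ← map_smul, smul_eq_mul, mul_one]
  simp only [wirtingerBar, h, ContinuousLinearMap.coe_restrictScalars', h2]
  linear_combination (1 / 2 * fderiv ℂ u z 1) * I_sq

theorem aestronglyMeasurable_cauchyKernel : AEStronglyMeasurable cauchyKernel volume := by
  unfold cauchyKernel
  exact (measurable_const.mul measurable_id).inv.aestronglyMeasurable

theorem norm_cauchyKernel_le (z : ℂ) : ‖cauchyKernel z‖ ≤ 1 * ‖z‖⁻¹ := by
  rw [cauchyKernel, norm_inv, norm_mul, mul_inv, norm_real, Real.norm_of_nonneg Real.pi_pos.le]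
  gcongr
  exact inv_le_one_of_one_le₀ (by linarith [Real.pi_gt_three])

/-- A measurable function of size `O(1 / |z|)` on `ℂ` is locally integrable. -/
theorem locallyIntegrable_of_norm_le_inv {f : ℂ → ℂ} {C : ℝ} (hf : ∀ z, ‖f z‖ ≤ C * ‖z‖⁻¹)
    (hm : AEStronglyMeasurable f volume) : LocallyIntegrable f volume := by
  refine locallyIntegrable_of_norm_le_rpow (C := C) (α := 1) (by simp) (by simp) ?_ hm
  filter_upwards with z
  rw [Real.rpow_neg_one]
  exact hf z

theorem locallyIntegrable_cauchyKernel : LocallyIntegrable cauchyKernel volume :=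
  locallyIntegrable_of_norm_le_inv norm_cauchyKernel_le aestronglyMeasurable_cauchyKernel

/-- The polar domain is unbounded only in the radius, so vanishing for large radius reduces
everything to a compact rectangle. This justifies Fubini in the Cauchy-Pompeiu formula. -/
theorem integrableOn_polar_target {A : ℝ × ℝ → ℂ} (hA : Continuous A) {R : ℝ}
    (h0 : ∀ p : ℝ × ℝ, R < p.1 → A p = 0) :
    IntegrableOn A (Set.Ioi (0 : ℝ) ×ˢ Set.Ioo (-Real.pi) Real.pi) volume := by
  have h1 : IntegrableOn A (Set.Icc (0 : ℝ) R ×ˢ Set.Icc (-Real.pi) Real.pi) volume :=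
    hA.continuousOn.integrableOn_compact (isCompact_Icc.prod isCompact_Icc)
  refine h1.of_forall_sdiff_eq_zero (measurableSet_Ioi.prod measurableSet_Ioo) ?_
  rintro p ⟨⟨hp1, hp2⟩, hp⟩
  refine h0 p ?_
  by_contra hR
  exact hp ⟨⟨le_of_lt hp1, not_lt.1 hR⟩, ⟨hp2.1.le, hp2.2.le⟩⟩

/-- The **Cauchy-Pompeiu formula** for compactly supported functions. -/
theorem integral_cauchyKernel_mul_wirtingerBar {u : ℂ → ℂ} (hu : ContDiff ℝ 1 u)
    (hc : HasCompactSupport u) : ∫ z, cauchyKernel z * wirtingerBar u z = -u 0 := by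
  have hpi : (Real.pi : ℂ) ≠ 0 := ofReal_ne_zero.2 Real.pi_ne_zero
  let e : ℝ → ℂ := fun t => exp (t * I)
  have he : Continuous e := by fun_prop
  have hed : ∀ t, HasDerivAt e (I * e t) t := by
    intro t
    have h := ((hasDerivAt_id t).ofReal_comp.mul_const I).cexp
    simpa [e, mul_comm] using h
  have hnorm : ∀ t, ‖e t‖ = 1 := fun t => norm_exp_ofReal_mul_I t
  have hdu : Continuous (fderiv ℝ u) := hu.continuous_fderiv one_ne_zero
  obtain ⟨R, hR⟩ : ∃ R : ℝ, ∀ z : ℂ, R < ‖z‖ → u z = 0 ∧ fderiv ℝ u z = 0 := by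
    obtain ⟨R, hR⟩ := hc.isCompact.isBounded.exists_norm_le
    refine ⟨R, fun z hz => ?_⟩
    have h1 : z ∉ tsupport u := fun h => absurd (hR z h) (not_le.2 hz)
    exact ⟨image_eq_zero_of_notMem_tsupport h1,
      image_eq_zero_of_notMem_tsupport fun h => h1 (tsupport_fderiv_subset ℝ h)⟩
  -- At the point r e^{it}, A is the radial derivative of u, and r B is the angular one.
  let A : ℝ × ℝ → ℂ := fun p => fderiv ℝ u (p.1 • e p.2) (e p.2)
  let B : ℝ × ℝ → ℂ := fun p => fderiv ℝ u (p.1 • e p.2) (I * e p.2)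
  have hcA : Continuous A := by
    refine (hdu.comp (by fun_prop)).clm_apply (by fun_prop)
  have hcB : Continuous B := by
    refine (hdu.comp (by fun_prop)).clm_apply (by fun_prop)
  have hz0 : ∀ p : ℝ × ℝ, max R 0 < p.1 → fderiv ℝ u (p.1 • e p.2) = 0 := by
    intro p hp
    refine (hR _ ?_).2
    rw [norm_smul, hnorm, mul_one, Real.norm_of_nonneg ((le_max_right _ _).trans hp.le)]
    exact (le_max_left _ _).trans_lt hp
  have hiA := integrableOn_polar_target hcA (R := max R 0) fun p hp => by
    simp only [A, hz0 p hp, zero_apply]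
  have hiB := integrableOn_polar_target hcB (R := max R 0) fun p hp => by
    simp only [B, hz0 p hp, zero_apply]
  -- Fundamental theorem of calculus along a ray; below, the integral of B over a circle vanishes by
  -- periodicity.
  have hline : ∀ t : ℝ, ∫ r in Set.Ioi (0 : ℝ), A (r, t) = -u 0 := by
    intro t
    have hd : ∀ r : ℝ, HasDerivAt (fun r : ℝ => u (r • e t)) (A (r, t)) r := by
      intro r
      have h1 : HasDerivAt (fun r : ℝ => r • e t) (e t) r := by
        simpa using (hasDerivAt_id r).smul_const (e t)
      exact ((hu.differentiable one_ne_zero) _).hasFDerivAt.comp_hasDerivAt r h1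
    have hcs : HasCompactSupport fun r : ℝ => u (r • e t) := by
      refine HasCompactSupport.intro (isCompact_Icc (a := -R) (b := R)) fun r hr => ?_
      refine (hR _ ?_).1
      rw [norm_smul, hnorm, mul_one, Real.norm_eq_abs]
      by_contra h
      exact hr (abs_le.1 (not_lt.1 h))
    have hcd : ContDiff ℝ 1 fun r : ℝ => u (r • e t) :=
      hu.comp (contDiff_id.smul contDiff_const)
    have h := hcs.integral_Ioi_deriv_eq hcd 0
    simp only [zero_smul] at h
    rw [← h]
    exact integral_congr_ae (.of_forall fun r => (hd r).deriv.symm)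
  have hcirc : ∀ r ∈ Set.Ioi (0 : ℝ), ∫ t in Set.Ioo (-Real.pi) Real.pi, B (r, t) = 0 := by
    intro r hr
    have hd : ∀ t : ℝ, HasDerivAt (fun t : ℝ => u (r • e t)) (r • B (r, t)) t := by
      intro t
      have h1 : HasDerivAt (fun t : ℝ => r • e t) (r • (I * e t)) t := (hed t).const_smul r
      have h2 := ((hu.differentiable one_ne_zero) _).hasFDerivAt.comp_hasDerivAt t h1
      rwa [map_smul] at h2
    have hcont : Continuous fun t => r • B (r, t) :=
      (hcB.comp (continuous_const.prodMk continuous_id)).const_smul r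
    have h := intervalIntegral.integral_eq_sub_of_hasDerivAt (a := -Real.pi) (b := Real.pi)
      (fun t _ => hd t) (hcont.intervalIntegrable _ _)
    rw [intervalIntegral.integral_of_le (by linarith [Real.pi_pos]), integral_Ioc_eq_integral_Ioo,
      integral_smul] at h
    have hper : e Real.pi = e (-Real.pi) := by
      simp only [e]
      rw [exp_pi_mul_I, ofReal_neg, neg_mul, exp_neg, exp_pi_mul_I]
      norm_num
    rw [hper, sub_self, smul_eq_zero] at h
    exact h.resolve_left (ne_of_gt hr)
  -- Here ∂u/∂z̄ = (e^{it}/2)(A + iB), and the polar Jacobian r together with the kernel 1/(π r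
  -- e^{it}) leaves (A + iB)/(2π), which has no singularity.
  have hpol : ∀ p ∈ Set.Ioi (0 : ℝ) ×ˢ Set.Ioo (-Real.pi) Real.pi,
      p.1 • (cauchyKernel (Complex.polarCoord.symm p) *
        wirtingerBar u (Complex.polarCoord.symm p)) =
      (2 * Real.pi : ℂ)⁻¹ * A p + ((2 * Real.pi : ℂ)⁻¹ * I) * B p := by
    rintro ⟨r, t⟩ ⟨hr, -⟩
    have hr0 : (r : ℂ) ≠ 0 := ofReal_ne_zero.2 (ne_of_gt hr)
    have hs : Complex.polarCoord.symm (r, t) = r • e t := by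
      rw [Complex.polarCoord_symm_apply, real_smul]
      simp only [e, exp_mul_I]
      push_cast
      ring
    have h1 : (e t).re = Real.cos t := exp_ofReal_mul_I_re t
    have h2 : (e t).im = Real.sin t := exp_ofReal_mul_I_im t
    have h3 : (Real.cos t : ℂ) ^ 2 + (Real.sin t : ℂ) ^ 2 = 1 := by
      exact_mod_cast Real.cos_sq_add_sin_sq t
    have h4 : e t = Real.cos t + Real.sin t * I := by
      simp only [e, exp_mul_I, ofReal_cos, ofReal_sin]
    have h5 : (e t)⁻¹ = Real.cos t - Real.sin t * I := by
      rw [h4]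
      refine inv_eq_of_mul_eq_one_right ?_
      linear_combination h3 - (Real.sin t : ℂ) ^ 2 * I_sq
    rw [hs]
    simp only [A, B, cauchyKernel, wirtingerBar]
    rw [fderiv_complex_apply _ (e t), fderiv_complex_apply _ (I * e t), real_smul, real_smul,
      mul_inv, mul_inv, h5]
    simp only [mul_re, mul_im, I_re, I_im, h1, h2, zero_mul, one_mul, zero_sub, zero_add, ofReal_neg]
    field_simp
    linear_combination (-(Real.sin t : ℂ) * (fderiv ℝ u (r * e t) I)) * I_sq
  rw [← Complex.integral_comp_polarCoord_symm]
  have htarget : polarCoord.target = Set.Ioi (0 : ℝ) ×ˢ Set.Ioo (-Real.pi) Real.pi := rfl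
  rw [htarget, setIntegral_congr_fun (measurableSet_Ioi.prod measurableSet_Ioo) hpol,
    integral_add (hiA.const_mul _) (hiB.const_mul _), integral_const_mul, integral_const_mul]
  have hB0 : ∫ p in Set.Ioi (0 : ℝ) ×ˢ Set.Ioo (-Real.pi) Real.pi, B p = 0 := by
    rw [Measure.volume_eq_prod, setIntegral_prod _ hiB]
    exact setIntegral_eq_zero_of_forall_eq_zero hcirc
  have hA0 : ∫ p in Set.Ioi (0 : ℝ) ×ˢ Set.Ioo (-Real.pi) Real.pi, A p = -(2 * Real.pi) * u 0 := by
    rw [Measure.volume_eq_prod, setIntegral_prod _ hiA, integral_integral_swap]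
    · simp only [hline]
      rw [setIntegral_const]
      simp only [measureReal_def, Real.volume_Ioo, sub_neg_eq_add]
      rw [ENNReal.toReal_ofReal (by linarith [Real.pi_pos]), real_smul]
      push_cast
      ring
    · rw [IntegrableOn, Measure.volume_eq_prod, ← Measure.prod_restrict] at hiA
      exact hiA
  rw [hA0, hB0]
  field_simp
  ring

/-- **Stokes' theorem** for compactly supported functions. -/
theorem integral_wirtingerBar_eq_zero {u : ℂ → ℂ} (hu : ContDiff ℝ 1 u)
    (hc : HasCompactSupport u) : ∫ z, wirtingerBar u z = 0 := by
  have hpi : (Real.pi : ℂ) ≠ 0 := ofReal_ne_zero.2 Real.pi_ne_zero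
  -- The holomorphic factor πz cancels the kernel and makes the value at the origin vanish.
  have h := integral_cauchyKernel_mul_wirtingerBar (u := fun z => (Real.pi * z) * u z)
    ((contDiff_const.mul contDiff_id).mul hu) hc.mul_left
  rw [mul_zero, zero_mul, neg_zero] at h
  rw [← h]
  refine integral_congr_ae ?_
  filter_upwards [compl_mem_ae_iff.2 (measure_singleton (0 : ℂ))] with z hz
  have hz' : z ≠ 0 := hz
  rw [wirtingerBar_mul (u := fun z => (Real.pi : ℂ) * z) (by fun_prop)
      (hu.differentiable one_ne_zero z),
    wirtingerBar_of_differentiableAt (u := fun z => (Real.pi : ℂ) * z) (by fun_prop), cauchyKernel, zero_mul, zero_add,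
    inv_mul_cancel_left₀ (mul_ne_zero hpi hz')]

end CauchyPompeiu

/-! ### Convolution and the parametrix of ∂/∂z̄ -/

section Convolution

open MeasureTheory Complex

/-- The convolution `z ↦ ∫ κ(t) ψ(z - t) dt`. -/
def smulConv {F : Type*} [NormedAddCommGroup F] [NormedSpace ℝ F]
    [NormedSpace ℂ F] (κ : ℂ → ℂ) (ψ : ℂ → F) (z : ℂ) : F :=
  ∫ t, κ t • ψ (z - t)

theorem smulConv_eq_convolution {F : Type*} [NormedAddCommGroup F] [NormedSpace ℝ F]
    [NormedSpace ℂ F] [IsScalarTower ℝ ℂ F] (κ : ℂ → ℂ)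
    (ψ : ℂ → F) :
    smulConv κ ψ = convolution κ ψ (ContinuousLinearMap.lsmul ℝ ℂ : ℂ →L[ℝ] F →L[ℝ] F) volume :=
  rfl

theorem integrable_smulConv {F : Type*} [NormedAddCommGroup F] [NormedSpace ℝ F]
    [NormedSpace ℂ F] [IsScalarTower ℝ ℂ F] {κ : ℂ → ℂ}
    {ψ : ℂ → F} (hκ : LocallyIntegrable κ volume) (hψ : Continuous ψ) (hc : HasCompactSupport ψ)
    (z : ℂ) : Integrable (fun t => κ t • ψ (z - t)) volume :=
  HasCompactSupport.convolutionExists_right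
    (ContinuousLinearMap.lsmul ℝ ℂ : ℂ →L[ℝ] F →L[ℝ] F) hc hκ hψ z

theorem hasFDerivAt_smulConv {F : Type*} [NormedAddCommGroup F] [NormedSpace ℝ F]
    [NormedSpace ℂ F] [IsScalarTower ℝ ℂ F] {κ : ℂ → ℂ}
    {ψ : ℂ → F} (hκ : LocallyIntegrable κ volume) (hψ : ContDiff ℝ 1 ψ) (hc : HasCompactSupport ψ)
    (z : ℂ) : HasFDerivAt (smulConv κ ψ) (smulConv κ (fderiv ℝ ψ) z) z := by
  have h := hc.hasFDerivAt_convolution_right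
    (ContinuousLinearMap.lsmul ℝ ℂ : ℂ →L[ℝ] F →L[ℝ] F) hκ hψ z
  rw [← smulConv_eq_convolution] at h
  refine h.congr_fderiv ?_
  unfold convolution smulConv
  congr 1

/-- Evaluation at a vector keeps the integral in F itself, which is the form used when
differentiating repeatedly. -/
theorem fderiv_smulConv_apply {F : Type*} [NormedAddCommGroup F] [NormedSpace ℝ F]
    [NormedSpace ℂ F] [IsScalarTower ℝ ℂ F] [CompleteSpace F] {κ : ℂ → ℂ}
    {ψ : ℂ → F} (hκ : LocallyIntegrable κ volume) (hψ : ContDiff ℝ 1 ψ) (hc : HasCompactSupport ψ)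
    (z v : ℂ) : Integrable (fun t => κ t • fderiv ℝ ψ (z - t) v) volume ∧
      fderiv ℝ (smulConv κ ψ) z v = ∫ t, κ t • fderiv ℝ ψ (z - t) v := by
  have hint : Integrable (fun t => κ t • fderiv ℝ ψ (z - t)) volume :=
    integrable_smulConv hκ (hψ.continuous_fderiv one_ne_zero) (hc.fderiv ℝ) z
  refine ⟨hint.apply_continuousLinearMap v, ?_⟩
  rw [(hasFDerivAt_smulConv hκ hψ hc z).fderiv, smulConv, ContinuousLinearMap.integral_apply hint]
  rfl

theorem contDiff_smulConv {F : Type*} [NormedAddCommGroup F] [NormedSpace ℝ F]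
    [NormedSpace ℂ F] [IsScalarTower ℝ ℂ F] {κ : ℂ → ℂ}
    {ψ : ℂ → F} {n : ℕ∞} (hκ : LocallyIntegrable κ volume) (hψ : ContDiff ℝ n ψ)
    (hc : HasCompactSupport ψ) : ContDiff ℝ n (smulConv κ ψ) :=
  HasCompactSupport.contDiff_convolution_right (𝕜 := ℝ) (ContinuousLinearMap.lsmul ℝ ℂ : ℂ →L[ℝ] F →L[ℝ] F) hc hκ hψ

/-- All derivatives fall on the smooth factor, so κ may be singular and the seminorms of the
convolution are still controlled by those of ψ. -/
theorem iteratedFDeriv_smulConv {F : Type*} [NormedAddCommGroup F] [NormedSpace ℝ F]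
    [NormedSpace ℂ F] [IsScalarTower ℝ ℂ F]
    [CompleteSpace F] {κ : ℂ → ℂ}
    {ψ : ℂ → F} (hκ : LocallyIntegrable κ volume) (hψ : ContDiff ℝ (⊤ : ℕ∞) ψ)
    (hc : HasCompactSupport ψ) (i : ℕ) :
    iteratedFDeriv ℝ i (smulConv κ ψ) = smulConv κ (iteratedFDeriv ℝ i ψ) := by
  have hcd : ∀ j : ℕ, ContDiff ℝ (⊤ : ℕ∞) (iteratedFDeriv ℝ j ψ) := fun j =>
    hψ.iteratedFDeriv_right (by exact_mod_cast (le_top : (⊤ : ℕ∞) + (j : ℕ∞) ≤ ⊤))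
  have hint : ∀ (j : ℕ) z, Integrable (fun t => κ t • iteratedFDeriv ℝ j ψ (z - t)) volume :=
    fun j z => integrable_smulConv hκ (hcd j).continuous (hc.iteratedFDeriv j) z
  have happ : ∀ (j : ℕ) z m, smulConv κ (iteratedFDeriv ℝ j ψ) z m =
      ∫ t, κ t • iteratedFDeriv ℝ j ψ (z - t) m := fun j z m =>
    ContinuousMultilinearMap.integral_apply (hint j z) m
  induction i with
  | zero =>
    ext z m
    rw [happ, iteratedFDeriv_zero_apply]
    simp only [iteratedFDeriv_zero_apply]
    rfl
  | succ i ih =>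
    ext z m
    rw [happ, iteratedFDeriv_succ_apply_left, ih]
    obtain ⟨h1, h2⟩ := fderiv_smulConv_apply (ψ := iteratedFDeriv ℝ i ψ) hκ
      ((hcd i).of_le (by simp)) (hc.iteratedFDeriv i) z (m 0)
    rw [h2, ContinuousMultilinearMap.integral_apply h1]
    rfl

theorem smulConv_eq_zero {F : Type*} [NormedAddCommGroup F] [NormedSpace ℝ F]
    [NormedSpace ℂ F] [IsScalarTower ℝ ℂ F] {κ : ℂ → ℂ}
    {ψ : ℂ → F} {A B : Set ℂ} (hκ : tsupport κ ⊆ A) (hψ : tsupport ψ ⊆ B) {z : ℂ}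
    (hz : z ∉ A + B) : smulConv κ ψ z = 0 := by
  refine integral_eq_zero_of_ae (.of_forall fun t => ?_)
  by_cases h1 : t ∈ tsupport κ
  · have h2 : z - t ∉ tsupport ψ := fun h =>
      hz ⟨t, hκ h1, z - t, hψ h, add_sub_cancel _ _⟩
    simp only [image_eq_zero_of_notMem_tsupport h2, smul_zero, Pi.zero_apply]
  · simp only [image_eq_zero_of_notMem_tsupport h1, zero_smul, Pi.zero_apply]

theorem tsupport_smulConv_subset {F : Type*} [NormedAddCommGroup F] [NormedSpace ℝ F]
    [NormedSpace ℂ F] [IsScalarTower ℝ ℂ F] {κ : ℂ → ℂ}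
    {ψ : ℂ → F} {A B : Set ℂ} (hκ : tsupport κ ⊆ A) (hψ : tsupport ψ ⊆ B) (hA : IsCompact A)
    (hB : IsCompact B) : tsupport (smulConv κ ψ) ⊆ A + B :=
  closure_minimal (Function.support_subset_iff'.2 fun _ hz => smulConv_eq_zero hκ hψ hz)
    (hA.add hB).isClosed

theorem smulConv_comm (κ ψ : ℂ → ℂ) : smulConv κ ψ = smulConv ψ κ := by
  ext z
  rw [smulConv, ← integral_sub_left_eq_self _ volume z]
  simp only [smul_eq_mul, sub_sub_cancel, smulConv, mul_comm]

/-- Convolution with a compactly supported integrable function, as an operator on test functions on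
the complex plane. -/
theorem exists_smulConvCLM {κ : ℂ → ℂ} (hκ : LocallyIntegrable κ volume)
    (hc : HasCompactSupport κ) :
    ∃ B : 𝓓((⊤ : Opens ℂ), ℂ) →L[ℂ] 𝓓((⊤ : Opens ℂ), ℂ), ∀ f z, B f z = smulConv κ f z := by
  refine exists_testFunctionCLM (fun f => smulConv κ f) (fun f g x => ?_) (fun c f x => ?_)
    fun K _ => ⟨⟨tsupport κ + K, hc.isCompact.add K.isCompact⟩, fun _ _ => trivial, ?_, ?_⟩
  · rw [smulConv, smulConv, smulConv, ← integral_add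
      (integrable_smulConv hκ f.continuous f.hasCompactSupport x)
      (integrable_smulConv hκ g.continuous g.hasCompactSupport x)]
    exact integral_congr_ae (.of_forall fun t => smul_add _ _ _)
  · rw [smulConv, smulConv, ← integral_smul]
    exact integral_congr_ae (.of_forall fun t => smul_comm (κ t) c (f (x - t)))
  · intro f hf
    exact ⟨contDiff_smulConv hκ f.contDiff f.hasCompactSupport,
      fun z hz => smulConv_eq_zero subset_rfl hf hz⟩
  · intro i
    have hi : Integrable κ volume := by
      rw [← integrableOn_iff_integrable_of_support_subset (subset_tsupport κ)]
      exact hκ.integrableOn_isCompact hc.isCompact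
    refine ⟨∫ t, ‖κ t‖, integral_nonneg fun _ => norm_nonneg _, fun f _ M hM x _ => ?_⟩
    rw [iteratedFDeriv_smulConv hκ f.contDiff f.hasCompactSupport, ← integral_mul_const]
    refine norm_integral_le_of_norm_le (hi.norm.mul_const M) (.of_forall fun t => ?_)
    rw [norm_smul]
    exact mul_le_mul_of_nonneg_left (hM i le_rfl _) (norm_nonneg _)

theorem wirtingerBar_smulConv {κ ψ : ℂ → ℂ} (hκ : LocallyIntegrable κ volume)
    (hψ : ContDiff ℝ (⊤ : ℕ∞) ψ) (hc : HasCompactSupport ψ) :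
    wirtingerBar (smulConv κ ψ) = smulConv κ (wirtingerBar ψ) := by
  ext z
  obtain ⟨h1, h1'⟩ := fderiv_smulConv_apply hκ (hψ.of_le (by simp)) hc z 1
  obtain ⟨h2, h2'⟩ := fderiv_smulConv_apply hκ (hψ.of_le (by simp)) hc z I
  rw [wirtingerBar, h1', h2', ← integral_const_mul, ← integral_add h1 (h2.const_mul _),
    ← integral_const_mul, smulConv]
  refine integral_congr_ae (.of_forall fun t => ?_)
  simp only [wirtingerBar, smul_eq_mul]
  ring

/-- A parametrix for `∂/∂z̄`, supported near the origin. -/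
theorem exists_parametrix {r : ℝ} (hr : 0 < r) :
    ∃ κ g : ℂ → ℂ, LocallyIntegrable κ volume ∧ tsupport κ ⊆ Metric.closedBall 0 r ∧
      ContDiff ℝ (⊤ : ℕ∞) g ∧ tsupport g ⊆ Metric.closedBall 0 r ∧
      ∀ ψ : ℂ → ℂ, ContDiff ℝ (⊤ : ℕ∞) ψ → HasCompactSupport ψ → ∀ z,
        smulConv κ (wirtingerBar ψ) z = ψ z - smulConv g ψ z := by
  -- The cut-off is constant on the ball of radius r / 2, so its Wirtinger derivative vanishes there
  -- and removes the singularity of the kernel from g.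
  let θ : ContDiffBump (0 : ℂ) := ⟨r / 2, r, by linarith, by linarith⟩
  let Θ : ℂ → ℂ := fun z => (θ z : ℂ)
  have hΘ : ContDiff ℝ (⊤ : ℕ∞) Θ := ofRealCLM.contDiff.comp θ.contDiff
  have hΘs : tsupport Θ ⊆ Metric.closedBall 0 r := by
    refine (closure_mono ?_).trans θ.tsupport_eq.subset
    intro z hz hz'
    exact hz (by simp only [Θ, hz', ofReal_zero])
  have hΘc : HasCompactSupport Θ := HasCompactSupport.of_support_subset_isCompact
    (isCompact_closedBall 0 r) ((subset_tsupport _).trans hΘs)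
  have hd0 : ∀ z ∈ Metric.ball (0 : ℂ) (r / 2), fderiv ℝ Θ z = 0 := by
    intro z hz
    have h : Θ =ᶠ[nhds z] fun _ => 1 := by
      filter_upwards [Metric.isOpen_ball.mem_nhds hz] with w hw
      simp only [Θ, θ.one_of_mem_closedBall (Metric.ball_subset_closedBall hw), ofReal_one]
    rw [h.fderiv_eq, fderiv_fun_const, Pi.zero_apply]
  let g : ℂ → ℂ := fun z => -(cauchyKernel z * wirtingerBar Θ z)
  have hWs := tsupport_wirtingerBar_subset Θ
  have hW := contDiff_wirtingerBar hΘ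
  have hκ : LocallyIntegrable (fun z => cauchyKernel z * Θ z) volume := by
    refine locallyIntegrable_of_norm_le_inv (C := 1) (fun z => ?_)
      (aestronglyMeasurable_cauchyKernel.mul hΘ.continuous.aestronglyMeasurable)
    rw [norm_mul]
    refine (mul_le_of_le_one_right (norm_nonneg _) ?_).trans (norm_cauchyKernel_le z)
    simp only [Θ, norm_real, Real.norm_of_nonneg θ.nonneg]
    exact θ.le_one
  have hg : ContDiff ℝ (⊤ : ℕ∞) g := by
    rw [contDiff_iff_contDiffAt]
    intro z
    by_cases hz : z = 0
    · refine (contDiffAt_const (c := (0 : ℂ))).congr_of_eventuallyEq ?_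
      have h0 : Metric.ball (0 : ℂ) (r / 2) ∈ nhds z := by
        rw [hz]; exact Metric.ball_mem_nhds _ (by linarith)
      filter_upwards [h0] with w hw
      simp [g, wirtingerBar, hd0 w hw]
    · have h1 : ContDiffAt ℝ (⊤ : ℕ∞) cauchyKernel z := by
        unfold cauchyKernel
        exact ((contDiff_const.mul contDiff_id).contDiffAt (x := z)).inv
          (mul_ne_zero (ofReal_ne_zero.2 Real.pi_ne_zero) hz)
      exact (h1.mul hW.contDiffAt).neg
  refine ⟨fun z => cauchyKernel z * Θ z, g, hκ, ?_, hg, ?_, fun ψ hψ hψc z => ?_⟩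
  · exact (tsupport_mul_subset_right).trans hΘs
  · have : tsupport g ⊆ tsupport (wirtingerBar Θ) := by
      refine closure_mono fun z hz h0 => hz ?_
      simp [g, h0]
    exact this.trans (hWs.trans hΘs)
  · have hψ1 : ContDiff ℝ (⊤ : ℕ∞) (fun t => ψ (z - t)) := hψ.comp (contDiff_const.sub contDiff_id)
    have hu : ContDiff ℝ (⊤ : ℕ∞) (fun t => Θ t * ψ (z - t)) := hΘ.mul hψ1
    -- Cauchy-Pompeiu for t ↦ Θ(t) ψ(z - t), whose value at 0 is ψ(z). By Leibniz, one term is the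
    -- convolution with κ and the other the convolution with g.
    have hP := integral_cauchyKernel_mul_wirtingerBar (hu.of_le (by simp)) hΘc.mul_right
    have hΘ0 : Θ 0 = 1 := by
      simp only [Θ, θ.one_of_mem_closedBall (Metric.mem_closedBall_self (by
        change 0 ≤ r / 2; linarith)), ofReal_one]
    rw [hΘ0, one_mul, sub_zero] at hP
    have hwψ : ∀ t, wirtingerBar (fun t => ψ (z - t)) t = -wirtingerBar ψ (z - t) := by
      intro t
      have h1 : HasFDerivAt (fun t : ℂ => z - t) (-(ContinuousLinearMap.id ℝ ℂ)) t :=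
        (hasFDerivAt_id t).const_sub z
      have h2 := ((hψ.differentiable (by simp)) (z - t)).hasFDerivAt.comp t h1
      have h3 : fderiv ℝ (fun t => ψ (z - t)) t = _ := h2.fderiv
      simp only [wirtingerBar, h3]
      simp
      ring
    have hI1 : Integrable (fun t => cauchyKernel t * Θ t * wirtingerBar ψ (z - t)) volume := by
      refine integrable_smulConv hκ ?_ ?_ z
      · exact (contDiff_wirtingerBar hψ).continuous
      · exact hasCompactSupport_wirtingerBar hψc
    have hI2 : Integrable (fun t => g t * ψ (z - t)) volume :=
      integrable_smulConv hg.continuous.locallyIntegrable hψ.continuous hψc z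
    have h4 : ∀ t, cauchyKernel t * wirtingerBar (fun t => Θ t * ψ (z - t)) t =
        -(g t * ψ (z - t)) - cauchyKernel t * Θ t * wirtingerBar ψ (z - t) := by
      intro t
      rw [wirtingerBar_mul (hΘ.differentiable (by simp) t) (hψ1.differentiable (by simp) t), hwψ]
      simp only [g]
      ring
    simp only [h4] at hP
    rw [integral_sub (f := fun t => -(g t * ψ (z - t))) hI2.neg hI1, integral_neg] at hP
    simp only [smulConv, smul_eq_mul]
    linear_combination -hP

end Convolution

/-! ### Finite order and mollification of distributions -/

section Mollification

open MeasureTheory Complex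
open scoped BoundedContinuousFunction

section Translate

variable {M : Type*} [NormedAddCommGroup M]

/-- A continuous compactly supported function, translated by `w`, as a bounded function. -/
def translateBCF (G : ℂ → M) (hG : Continuous G) (hc : HasCompactSupport G) (w : ℂ) : ℂ →ᵇ M :=
  BoundedContinuousFunction.ofNormedAddCommGroup (fun z => G (z - w)) (by fun_prop)
    (hG.bounded_above_of_compact_support hc).choose
    fun z => (hG.bounded_above_of_compact_support hc).choose_spec (z - w)

@[simp]
theorem translateBCF_apply (G : ℂ → M) (hG : Continuous G) (hc : HasCompactSupport G) (w z : ℂ) :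
    translateBCF G hG hc w z = G (z - w) :=
  rfl

theorem continuous_translateBCF (G : ℂ → M) (hG : Continuous G) (hc : HasCompactSupport G) :
    Continuous (translateBCF G hG hc) := by
  rw [Metric.continuous_iff]
  intro w ε hε
  obtain ⟨δ, hδ, h⟩ := Metric.uniformContinuous_iff.1
    (hc.uniformContinuous_of_continuous hG) (ε / 2) (half_pos hε)
  refine ⟨δ, hδ, fun w' hw' => ?_⟩
  refine ((BoundedContinuousFunction.dist_le (half_pos hε).le).2 fun z => ?_).trans_lt
    (half_lt_self hε)
  refine (h ?_).le
  rwa [dist_sub_left]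

variable [NormedSpace ℝ M]

/-- The mean value inequality bounds the error at each point by the oscillation of the derivative of
G, which is small uniformly in the point because this derivative is uniformly continuous. The
derivative in direction v is the translate of -dG(v). -/
theorem exists_hasFDerivAt_translateBCF (G : ℂ → M) (hG : ContDiff ℝ 1 G)
    (hc : HasCompactSupport G) :
    ∃ L : ℂ → ℂ →L[ℝ] (ℂ →ᵇ M), (∀ w, HasFDerivAt (translateBCF G hG.continuous hc) (L w) w) ∧
      Continuous L := by
  have hd : Continuous (fderiv ℝ G) := hG.continuous_fderiv one_ne_zero
  have hdc : HasCompactSupport (fderiv ℝ G) := hc.fderiv ℝ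
  have hv : ∀ v : ℂ, Continuous fun z => -fderiv ℝ G z v := fun v =>
    (hd.clm_apply continuous_const).neg
  have hvc : ∀ v : ℂ, HasCompactSupport fun z => -fderiv ℝ G z v := fun v =>
    hdc.mono fun z hz h0 => hz (by simp [h0])
  let L : ℂ → ℂ →L[ℝ] (ℂ →ᵇ M) := fun w => LinearMap.toContinuousLinearMap
    { toFun v := translateBCF _ (hv v) (hvc v) w
      map_add' v v' := by
        ext z
        simp only [translateBCF_apply, map_add, BoundedContinuousFunction.add_apply]
        abel
      map_smul' c v := by
        ext z
        change -fderiv ℝ G (z - w) (c • v) = c • -fderiv ℝ G (z - w) v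
        rw [map_smul, smul_neg] }
  have hL : ∀ w v z, L w v z = -fderiv ℝ G (z - w) v := fun w v z => rfl
  refine ⟨L, fun w => ?_, ?_⟩
  · rw [hasFDerivAt_iff_isLittleO, Asymptotics.isLittleO_iff]
    intro c hc0
    obtain ⟨δ, hδ, h⟩ := Metric.uniformContinuous_iff.1
      (hdc.uniformContinuous_of_continuous hd) c hc0
    filter_upwards [Metric.ball_mem_nhds w hδ] with w' hw'
    rw [BoundedContinuousFunction.norm_le (by positivity)]
    intro z
    have h1 := (convex_ball (z - w) δ).norm_image_sub_le_of_norm_fderiv_le' (𝕜 := ℝ) (f := G)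
      (φ := fderiv ℝ G (z - w)) (C := c) (x := z - w) (y := z - w')
      (fun y _ => hG.differentiable one_ne_zero y)
      (fun y hy => by
        rw [← dist_eq_norm]
        exact (h hy).le) (Metric.mem_ball_self hδ) (by
          rw [Metric.mem_ball, dist_sub_left]
          exact hw')
    have h2 : z - w' - (z - w) = -(w' - w) := by ring
    rw [h2, norm_neg, map_neg] at h1
    exact h1
  · rw [continuous_clm_apply]
    exact fun v => continuous_translateBCF _ (hv v) (hvc v)

end Translate

variable {N : ℕ} {M : Fin N → Type*} [∀ i, NormedAddCommGroup (M i)] [∀ i, NormedSpace ℝ (M i)]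
  [∀ i, NormedSpace ℂ (M i)] [∀ i, IsScalarTower ℝ ℂ (M i)]

/-- With G the family of derivatives of g, this is the regularity of w ↦ T (g(· - w)). Class C¹ is
enough to apply the Cauchy-Riemann equation afterwards. -/
theorem contDiff_clm_translateBCF (Λ : (∀ i, ℂ →ᵇ M i) →L[ℂ] ℂ) (G : ∀ i, ℂ → M i)
    (hG : ∀ i, ContDiff ℝ 1 (G i)) (hc : ∀ i, HasCompactSupport (G i)) :
    ContDiff ℝ 1 fun w => Λ fun i => translateBCF (G i) (hG i).continuous (hc i) w := by
  choose L hL hLc using fun i => exists_hasFDerivAt_translateBCF (G i) (hG i) (hc i)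
  refine (Λ.restrictScalars ℝ).contDiff.comp (contDiff_pi.2 fun i => ?_)
  rw [contDiff_one_iff_fderiv]
  refine ⟨fun w => (hL i w).differentiableAt, ?_⟩
  convert hLc i
  exact funext fun w => (hL i w).fderiv

/-- The convolution is a Bochner integral of translates of G with weight ψ, in a Banach space of
bounded functions, and continuous functionals commute with such integrals. -/
theorem clm_smulConv_eq_integral {N : ℕ} {M : Fin N → Type*} [∀ i, NormedAddCommGroup (M i)]
    [∀ i, NormedSpace ℝ (M i)] [∀ i, NormedSpace ℂ (M i)] [∀ i, CompleteSpace (M i)] (Λ : (∀ i, ℂ →ᵇ M i) →L[ℂ] ℂ)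
    (G : ∀ i, ℂ → M i)
    (hG : ∀ i, Continuous (G i)) (hc : ∀ i, HasCompactSupport (G i)) {ψ : ℂ → ℂ}
    (hψ : Continuous ψ) (hψc : HasCompactSupport ψ) (J : ∀ i, ℂ →ᵇ M i)
    (hJ : ∀ i z, J i z = smulConv ψ (G i) z) :
    Λ J = ∫ w, ψ w * Λ fun i => translateBCF (G i) (hG i) (hc i) w := by
  let τ : ℂ → ∀ i, ℂ →ᵇ M i := fun w i => translateBCF (G i) (hG i) (hc i) w
  have hτ : Continuous τ := continuous_pi fun i => continuous_translateBCF _ _ _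
  have hint : Integrable (fun w => ψ w • τ w) volume := by
    refine Continuous.integrable_of_hasCompactSupport (hψ.smul hτ) ?_
    exact hψc.mono fun w hw h0 => hw (by simp [h0])
  have hJ' : J = ∫ w, ψ w • τ w := by
    funext i
    ext z
    let ev : (∀ i, ℂ →ᵇ M i) →L[ℂ] M i :=
      BoundedContinuousFunction.evalCLM ℂ z ∘L ContinuousLinearMap.proj i
    have h : ev (∫ w, ψ w • τ w) = ∫ w, ev (ψ w • τ w) := (ev.integral_comp_comm hint).symm
    rw [hJ]
    exact h.symm
  rw [hJ', ← Λ.integral_comp_comm hint]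
  exact integral_congr_ae (.of_forall fun w => by simp [τ])

/-- Hahn-Banach: the bound makes T a bounded functional on the range of J. -/
theorem exists_clm_extension {D B : Type*} [AddCommGroup D] [Module ℂ D] [NormedAddCommGroup B]
    [NormedSpace ℂ B] (J : D →ₗ[ℂ] B) (hJ : Function.Injective J) (T : D →ₗ[ℂ] ℂ) {C : ℝ}
    (hT : ∀ φ, ‖T φ‖ ≤ C * ‖J φ‖) : ∃ Λ : B →L[ℂ] ℂ, ∀ φ, Λ (J φ) = T φ := by
  let e := LinearEquiv.ofInjective J hJ
  let T₀ : LinearMap.range J →L[ℂ] ℂ := LinearMap.mkContinuous (T ∘ₗ e.symm.toLinearMap)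
    C fun x => by
      have h := hT (e.symm x)
      have h2 : J (e.symm x) = x := congrArg Subtype.val (e.apply_symm_apply x)
      rw [h2] at h
      exact h
  obtain ⟨Λ, hΛ, -⟩ := exists_extension_norm_eq (LinearMap.range J) T₀
  refine ⟨Λ, fun φ => ?_⟩
  have h := hΛ (e φ)
  change Λ (J φ) = T (e.symm (e φ)) at h
  rwa [LinearEquiv.symm_apply_apply] at h

/-- A distribution with compact support has finite order: it factors through finitely many
derivatives. -/
theorem exists_clm_structureMap {K : Compacts ℂ} (T : 𝓓_{K}(ℂ, ℂ) →L[ℂ] ℂ) :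
    ∃ (N : ℕ) (Λ : (∀ i : Fin N, ℂ →ᵇ (ContinuousMultilinearMap ℝ (fun _ : Fin i => ℂ) ℂ)) →L[ℂ] ℂ),
      ∀ φ, T φ = Λ fun i => ContDiffMapSupportedIn.structureMapCLM ℂ ⊤ i φ := by
  obtain ⟨s, C, -, hC⟩ := Seminorm.bound_of_continuous
    (ContDiffMapSupportedIn.withSeminorms ℂ ℂ ℂ ⊤ K) ((normSeminorm ℂ ℂ).comp T.toLinearMap)
    (continuous_norm.comp T.continuous)
  obtain ⟨n, hn⟩ := s.bddAbove
  -- All orders from 0 to n: n bounds the orders in the continuity estimate, and order 0 makes J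
  -- injective.
  let N := n + 1
  let J : 𝓓_{K}(ℂ, ℂ) →ₗ[ℂ]
      (∀ i : Fin N, ℂ →ᵇ (ContinuousMultilinearMap ℝ (fun _ : Fin i => ℂ) ℂ)) :=
    LinearMap.pi fun i => (ContDiffMapSupportedIn.structureMapCLM ℂ ⊤ i).toLinearMap
  have hbd : ∀ φ, ‖T φ‖ ≤ C * ‖J φ‖ := by
    intro φ
    refine (hC φ).trans ?_
    change (C : ℝ) * (s.sup (ContDiffMapSupportedIn.seminorm ℂ ℂ ℂ ⊤ K)) φ ≤ _
    refine mul_le_mul_of_nonneg_left ?_ C.2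
    refine Seminorm.finset_sup_apply_le (norm_nonneg _) fun i hi => ?_
    exact norm_le_pi_norm (J φ) ⟨i, Nat.lt_succ_of_le (hn hi)⟩
  have hinj : Function.Injective J := by
    intro φ φ' h
    exact ContDiffMapSupportedIn.structureMapCLM_zero_injective ℂ
      (congrFun h (⟨0, Nat.succ_pos n⟩ : Fin N))
  obtain ⟨Λ, hΛ⟩ := exists_clm_extension
    (B := ∀ i : Fin N, ℂ →ᵇ (ContinuousMultilinearMap ℝ (fun _ : Fin i => ℂ) ℂ)) J hinj
    T.toLinearMap (C := C) hbd
  exact ⟨N, Λ, fun φ => (hΛ φ).symm⟩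

/-- Convolution of a distribution on a compact set with a smooth function `g`: the result is a
function `f`, and `T (ψ * g) = ∫ ψ f`. -/
theorem exists_mollification {K : Compacts ℂ} (T : 𝓓_{K}(ℂ, ℂ) →L[ℂ] ℂ) {g : ℂ → ℂ}
    (hg : ContDiff ℝ (⊤ : ℕ∞) g) (hgc : HasCompactSupport g) :
    ∃ f : ℂ → ℂ, ContDiff ℝ 1 f ∧
      (∀ (w : ℂ) (φ : 𝓓_{K}(ℂ, ℂ)), (∀ z, φ z = g (z - w)) → T φ = f w) ∧
      ∀ ψ : ℂ → ℂ, Continuous ψ → HasCompactSupport ψ → ∀ φ : 𝓓_{K}(ℂ, ℂ),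
        (∀ z, φ z = smulConv ψ g z) → T φ = ∫ w, ψ w * f w := by
  obtain ⟨N, Λ, hΛ⟩ := exists_clm_structureMap T
  have hG : ∀ i : ℕ, ContDiff ℝ 1 (iteratedFDeriv ℝ i g) := fun i =>
    (hg.iteratedFDeriv_right (m := 1) (by
      exact_mod_cast (le_top : (1 : ℕ∞) + (i : ℕ∞) ≤ ⊤)))
  have hc : ∀ i : ℕ, HasCompactSupport (iteratedFDeriv ℝ i g) := fun i => hgc.iteratedFDeriv i
  refine ⟨fun w => Λ fun i => translateBCF _ (hG i).continuous (hc i) w,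
    contDiff_clm_translateBCF Λ _ (fun i => hG i) fun i => hc i, ?_, ?_⟩
  · intro w φ hφ
    rw [hΛ]
    congr 1
    funext i
    ext z : 1
    rw [ContDiffMapSupportedIn.structureMapCLM_top_apply, translateBCF_apply,
      show (φ : ℂ → ℂ) = fun z => g (z - w) from funext hφ, iteratedFDeriv_comp_sub]
  · intro ψ hψ hψc φ hφ
    rw [hΛ]
    refine clm_smulConv_eq_integral Λ _ (fun i => (hG i).continuous) (fun i => hc i) hψ hψc _ fun i z => ?_
    rw [ContDiffMapSupportedIn.structureMapCLM_top_apply,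
      show (φ : ℂ → ℂ) = smulConv ψ g from funext hφ,
      iteratedFDeriv_smulConv hψ.locallyIntegrable hg hgc]

end Mollification

/-! ### Weyl's lemma in the plane -/

section Weyl

open MeasureTheory Complex

/-- The fundamental lemma of the calculus of variations, for continuous functions. -/
theorem eqOn_zero_of_integral_mul_eq_zero {O : Set ℂ} (hO : IsOpen O) {f : ℂ → ℂ}
    (hf : ContinuousOn f O)
    (h : ∀ ψ : ℂ → ℂ, ContDiff ℝ (⊤ : ℕ∞) ψ → HasCompactSupport ψ → tsupport ψ ⊆ O →
      ∫ w, f w * ψ w = 0) : Set.EqOn f 0 O := by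
  have h1 : ∀ᵐ x ∂(volume : Measure ℂ), x ∈ O → f x = 0 := by
    refine hO.ae_eq_zero_of_integral_contDiff_smul_eq_zero
      (hf.locallyIntegrableOn hO.measurableSet) fun g hg hgc hgO => ?_
    have hsub : tsupport (fun x => (g x : ℂ)) ⊆ tsupport g := closure_mono fun x hx h0 => hx (by
      simp only [h0, ofReal_zero])
    rw [← h (fun x => (g x : ℂ)) (ofRealCLM.contDiff.comp hg)
      (hgc.mono' ((subset_tsupport _).trans hsub)) (hsub.trans hgO)]
    exact integral_congr_ae (.of_forall fun x => by simp [mul_comm])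
  exact Measure.eqOn_open_of_ae_eq ((ae_restrict_iff' hO.measurableSet).2 h1) hO hf
    continuousOn_const

/-- A continuously differentiable function that is weakly holomorphic is holomorphic. -/
theorem differentiableOn_of_integral_mul_wirtingerBar {O : Set ℂ} (hO : IsOpen O) {f : ℂ → ℂ}
    (hf : ContDiff ℝ 1 f)
    (h : ∀ ψ : ℂ → ℂ, ContDiff ℝ (⊤ : ℕ∞) ψ → HasCompactSupport ψ → tsupport ψ ⊆ O →
      ∫ w, f w * wirtingerBar ψ w = 0) : DifferentiableOn ℂ f O := by
  have hz : Set.EqOn (wirtingerBar f) 0 O := by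
    refine eqOn_zero_of_integral_mul_eq_zero hO (continuous_wirtingerBar hf).continuousOn
      fun ψ hψ hψc hψO => ?_
    have hψ1 : ContDiff ℝ 1 ψ := hψ.of_le (by simp)
    -- Integration by parts: Stokes for f ψ moves ∂/∂z̄ from ψ to f.
    have h1 := integral_wirtingerBar_eq_zero (hf.mul hψ1) hψc.mul_left
    have h2 : ∀ w, wirtingerBar (fun w => f w * ψ w) w =
        wirtingerBar f w * ψ w + f w * wirtingerBar ψ w := fun w =>
      wirtingerBar_mul (hf.differentiable one_ne_zero w) (hψ1.differentiable one_ne_zero w)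
    rw [integral_congr_ae (.of_forall h2), integral_add, h ψ hψ hψc hψO, add_zero] at h1
    · exact h1
    · exact ((continuous_wirtingerBar hf).mul hψ.continuous).integrable_of_hasCompactSupport
        hψc.mul_left
    · exact (hf.continuous.mul (continuous_wirtingerBar hψ1)).integrable_of_hasCompactSupport
        (hasCompactSupport_wirtingerBar hψc).mul_left
  intro w hw
  refine (differentiableAt_complex_iff_differentiableAt_real.2
    ⟨hf.differentiable one_ne_zero w, ?_⟩).differentiableWithinAt
  have h1 : (1 / 2 : ℂ) * (fderiv ℝ f w 1 + I * fderiv ℝ f w I) = 0 := hz hw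
  rw [smul_eq_mul]
  linear_combination (-2 * I) * h1 + (fderiv ℝ f w I) * I_sq

theorem closedBall_add_thickening_subset (K : Set ℂ) (r : ℝ) :
    Metric.closedBall (0 : ℂ) r + Metric.thickening r K ⊆ Metric.cthickening (2 * r) K := by
  rintro _ ⟨t, ht, s, hs, rfl⟩
  obtain ⟨k, hk, hks⟩ := Metric.mem_thickening_iff.1 hs
  refine Metric.mem_cthickening_of_dist_le _ k _ K hk ?_
  have h1 : dist (t + s) s ≤ r := by
    simpa [dist_eq_norm] using ht
  linarith [dist_triangle (t + s) s k]

/-- **Weyl's lemma**, near a compact set. -/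
theorem exists_holomorphic_near_compact {Ω : Opens ℂ} (T : 𝓓(Ω, ℂ) →L[ℂ] ℂ)
    (hT : ∀ φ ψ : 𝓓(Ω, ℂ), (∀ z, ψ z = wirtingerBar φ z) → T ψ = 0) {K : Set ℂ} (hK : IsCompact K)
    (hKΩ : K ⊆ Ω) :
    ∃ O : Set ℂ, IsOpen O ∧ K ⊆ O ∧ O ⊆ Ω ∧ ∃ f : ℂ → ℂ, DifferentiableOn ℂ f O ∧
      ∀ ψ : 𝓓(Ω, ℂ), tsupport ψ ⊆ O → T ψ = ∫ w, f w * ψ w := by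
  obtain ⟨δ, hδ, hδΩ⟩ := hK.exists_cthickening_subset_open Ω.isOpen hKΩ
  -- One half of δ is for the neighbourhood of K where T is represented, the other for the supports
  -- of κ and g; convolutions then stay supported in the closed δ-neighbourhood, inside Ω.
  have hr : 0 < δ / 2 := half_pos hδ
  obtain ⟨κ, g, hκ, hκs, hg, hgs, hκg⟩ := exists_parametrix hr
  let K' : Compacts ℂ := ⟨Metric.cthickening δ K, hK.cthickening⟩
  have hK'Ω : (K' : Set ℂ) ⊆ Ω := hδΩ
  have hsub := closedBall_add_thickening_subset K (δ / 2)
  rw [mul_div_cancel₀ δ two_ne_zero] at hsub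
  have hball := isCompact_closedBall (0 : ℂ) (δ / 2)
  have hgc : HasCompactSupport g := .of_support_subset_isCompact hball ((subset_tsupport _).trans hgs)
  obtain ⟨f, hf, -, hfT⟩ := exists_mollification
    (T ∘L TestFunction.ofSupportedInCLM ℂ hK'Ω) hg hgc
  have hOK : Metric.thickening (δ / 2) K ⊆ Metric.cthickening δ K :=
    (Metric.thickening_subset_cthickening _ _).trans (Metric.cthickening_mono (by linarith) _)
  have hrep : ∀ ψ : 𝓓(Ω, ℂ), tsupport ψ ⊆ Metric.thickening (δ / 2) K →
      T ψ = ∫ w, f w * ψ w := by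
    intro ψ hψ
    have hsupp : ∀ α : ℂ → ℂ, tsupport α ⊆ Metric.closedBall 0 (δ / 2) →
        tsupport (smulConv α ψ) ⊆ K' := fun α hα =>
      (tsupport_smulConv_subset hα subset_rfl hball ψ.hasCompactSupport).trans
        ((Set.add_subset_add_left hψ).trans hsub)
    let χ : 𝓓(Ω, ℂ) := ⟨smulConv κ ψ, contDiff_smulConv hκ ψ.contDiff ψ.hasCompactSupport,
      .of_support_subset_isCompact K'.isCompact ((subset_tsupport _).trans (hsupp κ hκs)),
      (hsupp κ hκs).trans hK'Ω⟩
    let G : 𝓓_{K'}(ℂ, ℂ) := .of_support_subset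
      (contDiff_smulConv hg.continuous.locallyIntegrable ψ.contDiff ψ.hasCompactSupport)
      ((subset_tsupport _).trans (hsupp g hgs))
    -- By the parametrix identity, ψ - g * ψ is the Wirtinger derivative of the test function κ * ψ.
    have h1 : T (ψ - TestFunction.ofSupportedIn hK'Ω G) = 0 := by
      refine hT χ _ fun z => ?_
      change ψ z - smulConv g ψ z = wirtingerBar (smulConv κ ψ) z
      rw [wirtingerBar_smulConv hκ ψ.contDiff ψ.hasCompactSupport,
        hκg ψ ψ.contDiff ψ.hasCompactSupport]
    have h2 : T (TestFunction.ofSupportedIn hK'Ω G) = ∫ w, ψ w * f w := by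
      refine hfT ψ ψ.continuous ψ.hasCompactSupport G fun z => ?_
      rw [smulConv_comm]
      rfl
    rw [map_sub, h2, sub_eq_zero] at h1
    rw [h1]
    simp only [mul_comm]
  refine ⟨Metric.thickening (δ / 2) K, Metric.isOpen_thickening,
    Metric.self_subset_thickening hr K, hOK.trans hδΩ, f, ?_, hrep⟩
  refine differentiableOn_of_integral_mul_wirtingerBar Metric.isOpen_thickening hf
    fun ψ hψ hψc hψO => ?_
  have hW := tsupport_wirtingerBar_subset ψ
  let Ψ : 𝓓(Ω, ℂ) := ⟨ψ, hψ, hψc, hψO.trans (hOK.trans hδΩ)⟩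
  let Ψ' : 𝓓(Ω, ℂ) := ⟨wirtingerBar ψ, contDiff_wirtingerBar hψ,
    hasCompactSupport_wirtingerBar hψc, hW.trans (hψO.trans (hOK.trans hδΩ))⟩
  exact (hrep Ψ' (hW.trans hψO)).symm.trans (hT Ψ Ψ' fun z => rfl)

/-- **Weyl's lemma**: a distribution killed by `∂/∂z̄` is a holomorphic function. -/
theorem exists_holomorphic_of_wirtingerBar_eq_zero {Ω : Opens ℂ} (T : 𝓓(Ω, ℂ) →L[ℂ] ℂ)
    (hT : ∀ φ ψ : 𝓓(Ω, ℂ), (∀ z, ψ z = wirtingerBar φ z) → T ψ = 0) :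
    ∃ f : ℂ → ℂ, DifferentiableOn ℂ f Ω ∧ ∀ ψ : 𝓓(Ω, ℂ), T ψ = ∫ w, f w * ψ w := by
  choose O hO hKO hOΩ F hF hFT using fun (K : Set ℂ) (hK : IsCompact K) (hKΩ : K ⊆ Ω) =>
    exists_holomorphic_near_compact T hT hK hKΩ
  -- On an overlap both functions are continuous and represent the same distribution, hence they
  -- agree pointwise and can be glued.
  have huniq : ∀ K hK hKΩ L hL hLΩ, Set.EqOn (F K hK hKΩ) (F L hL hLΩ)
      (O K hK hKΩ ∩ O L hL hLΩ) := by
    intro K hK hKΩ L hL hLΩ w hw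
    have hK' := (hF K hK hKΩ).continuousOn.mono (Set.inter_subset_left (t := O L hL hLΩ))
    have hL' := (hF L hL hLΩ).continuousOn.mono (Set.inter_subset_right (s := O K hK hKΩ))
    have hopen := (hO K hK hKΩ).inter (hO L hL hLΩ)
    refine sub_eq_zero.1 (eqOn_zero_of_integral_mul_eq_zero hopen
      (f := fun w => F K hK hKΩ w - F L hL hLΩ w) (hK'.sub hL') (fun ψ hψ hψc hψO => ?_) hw)
    have hint : ∀ f : ℂ → ℂ, ContinuousOn f (O K hK hKΩ ∩ O L hL hLΩ) →
        Integrable (fun w => f w * ψ w) volume := by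
      intro f hf
      have h1 := (hf.mono hψO).mul hψ.continuous.continuousOn
      refine (integrableOn_iff_integrable_of_support_subset (s := tsupport ψ) ?_).1
        (h1.integrableOn_compact hψc.isCompact)
      exact fun x hx => subset_tsupport _ (right_ne_zero_of_mul hx)
    let Ψ : 𝓓(Ω, ℂ) := ⟨ψ, hψ, hψc, hψO.trans (Set.inter_subset_left.trans (hOΩ _ _ _))⟩
    have h1 := hFT K hK hKΩ Ψ (hψO.trans Set.inter_subset_left)
    have h2 := hFT L hL hLΩ Ψ (hψO.trans Set.inter_subset_right)
    simp only [sub_mul]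
    rw [integral_sub (hint _ hK') (hint _ hL'), sub_eq_zero]
    exact h1.symm.trans h2
  classical
  let f : ℂ → ℂ := fun w => if hw : w ∈ Ω then
    F {w} isCompact_singleton (Set.singleton_subset_iff.2 hw) w else 0
  have hf : ∀ K hK hKΩ, Set.EqOn f (F K hK hKΩ) (O K hK hKΩ) := by
    intro K hK hKΩ w hw
    have hwΩ : w ∈ Ω := hOΩ K hK hKΩ hw
    simp only [f, dif_pos hwΩ]
    exact huniq _ _ _ _ _ _ ⟨hKO _ _ _ (Set.mem_singleton w), hw⟩
  refine ⟨f, fun w hw => ?_, fun ψ => ?_⟩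
  · have hs : ({w} : Set ℂ) ⊆ Ω := Set.singleton_subset_iff.2 hw
    have hn := (hO {w} isCompact_singleton hs).mem_nhds (hKO {w} isCompact_singleton hs rfl)
    refine DifferentiableAt.differentiableWithinAt ?_
    exact ((hF {w} isCompact_singleton hs).differentiableAt hn).congr_of_eventuallyEq
      ((hf _ _ _).eventuallyEq_of_mem hn)
  -- The local statement holds near any compact set, in particular near the support of ψ, so no
  -- partition of unity is needed.
  · have hK := ψ.hasCompactSupport.isCompact
    rw [hFT _ hK ψ.tsupport_subset ψ (hKO _ _ _)]
    refine integral_congr_ae (.of_forall fun w => ?_)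
    by_cases hw : w ∈ tsupport ψ
    · simp only [hf _ hK ψ.tsupport_subset (hKO _ _ _ hw)]
    · simp only [image_eq_zero_of_notMem_tsupport hw, mul_zero]

end Weyl

/-! ### The Cauchy transform and primitives of compactly supported distributions -/

section CauchyTransform

open MeasureTheory Complex

/-- Both variables may be confined to a ball; there κ is integrable and G is a bounded factor. -/
theorem integrable_mul_of_locallyIntegrable {κ : ℂ → ℂ} (hκ : LocallyIntegrable κ volume)
    {G : ℂ × ℂ → ℂ} (hG : Continuous G) {R : ℝ}
    (h0 : ∀ p : ℂ × ℂ, R < ‖p.1‖ ∨ R < ‖p.2‖ → G p = 0) :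
    Integrable (fun p : ℂ × ℂ => κ p.2 * G p) ((volume : Measure ℂ).prod volume) := by
  let B : Set ℂ := Metric.closedBall 0 R
  have hB : MeasurableSet B := Metric.isClosed_closedBall.measurableSet
  have h1 : Integrable (B.indicator fun _ => (1 : ℂ)) volume :=
    (integrable_indicator_iff hB).2 (integrableOn_const (isCompact_closedBall 0 R).measure_lt_top.ne)
  have h2 : Integrable (B.indicator κ) volume :=
    (integrable_indicator_iff hB).2 (hκ.integrableOn_isCompact (isCompact_closedBall 0 R))
  have hc : HasCompactSupport G := by
    refine HasCompactSupport.intro ((isCompact_closedBall (0 : ℂ) R).prod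
      (isCompact_closedBall (0 : ℂ) R)) fun p hp => h0 p ?_
    by_contra h
    push Not at h
    exact hp ⟨mem_closedBall_zero_iff.2 h.1, mem_closedBall_zero_iff.2 h.2⟩
  obtain ⟨C, hC⟩ := hG.bounded_above_of_compact_support hc
  have h3 := (h1.mul_prod h2).mul_bdd hG.aestronglyMeasurable (.of_forall hC)
  refine h3.congr (.of_forall fun p => ?_)
  by_cases hp : p.1 ∈ B ∧ p.2 ∈ B
  · simp [Set.indicator_of_mem hp.1, Set.indicator_of_mem hp.2]
  · have : G p = 0 := by
      refine h0 p ?_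
      by_contra h
      push Not at h
      exact hp ⟨mem_closedBall_zero_iff.2 h.1, mem_closedBall_zero_iff.2 h.2⟩
    simp [this]

theorem integral_mul_swap {κ : ℂ → ℂ} (hκ : LocallyIntegrable κ volume)
    {G : ℂ × ℂ → ℂ} (hG : Continuous G) {R : ℝ}
    (h0 : ∀ p : ℂ × ℂ, R < ‖p.1‖ ∨ R < ‖p.2‖ → G p = 0) :
    ∫ w, ∫ t, κ t * G (w, t) = ∫ t, κ t * ∫ w, G (w, t) := by
  rw [integral_integral_swap (integrable_mul_of_locallyIntegrable hκ hG h0)]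
  simp only [integral_const_mul]

theorem exists_norm_bound_of_hasCompactSupport {g : ℂ → ℂ} (hg : HasCompactSupport g) :
    ∃ R : ℝ, ∀ w, R < ‖w‖ → g w = 0 := by
  obtain ⟨R, hR⟩ := hg.isCompact.isBounded.exists_norm_le
  exact ⟨R, fun z hz => image_eq_zero_of_notMem_tsupport fun h => absurd (hR z h) (not_le.2 hz)⟩

/-- The Cauchy transform of a compactly supported continuous function solves the inhomogeneous
Cauchy-Riemann equation weakly. -/
theorem integral_smulConv_cauchyKernel_mul_wirtingerBar {g φ : ℂ → ℂ} (hg : Continuous g)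
    (hgc : HasCompactSupport g) (hφ : ContDiff ℝ 1 φ) (hφc : HasCompactSupport φ) :
    ∫ w, smulConv cauchyKernel g w * wirtingerBar φ w = -∫ w, g w * φ w := by
  have hψ := continuous_wirtingerBar hφ
  obtain ⟨A, hA⟩ := exists_norm_bound_of_hasCompactSupport (hasCompactSupport_wirtingerBar hφc)
  obtain ⟨B, hB⟩ := exists_norm_bound_of_hasCompactSupport hgc
  have h1 : ∀ w, smulConv cauchyKernel g w * wirtingerBar φ w =
      ∫ t, cauchyKernel t * (g (w - t) * wirtingerBar φ w) := by
    intro w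
    rw [smulConv, ← integral_mul_const]
    simp only [smul_eq_mul, mul_assoc]
  have h2 : ∀ t, ∫ w, g (w - t) * wirtingerBar φ w = ∫ u, g u * wirtingerBar φ (u + t) := by
    intro t
    rw [← integral_add_right_eq_self _ t]
    simp only [add_sub_cancel_right]
  have h3 : ∀ u, ∫ t, cauchyKernel t * (g u * wirtingerBar φ (u + t)) = -(g u * φ u) := by
    intro u
    have hs : ∀ t, wirtingerBar (fun t => φ (u + t)) t = wirtingerBar φ (u + t) := by
      intro t
      simp only [wirtingerBar, fderiv_comp_add_left]
    have hP := integral_cauchyKernel_mul_wirtingerBar (u := fun t => φ (u + t))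
      (hφ.comp (contDiff_const.add contDiff_id)) (hφc.comp_homeomorph (Homeomorph.addLeft u))
    simp only [hs, add_zero] at hP
    rw [← mul_neg, ← hP, ← integral_const_mul]
    refine integral_congr_ae (.of_forall fun t => ?_)
    simp only
    ring
  simp only [h1]
  rw [integral_mul_swap (G := fun p => g (p.1 - p.2) * wirtingerBar φ p.1) (R := |A| + |B|)
    locallyIntegrable_cauchyKernel (by fun_prop)]
  · simp only [h2]
    rw [← integral_mul_swap (G := fun p => g p.1 * wirtingerBar φ (p.1 + p.2)) (R := |A| + |B|)
      locallyIntegrable_cauchyKernel (by fun_prop)]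
    · simp only [h3]
      rw [integral_neg]
    · rintro ⟨u, t⟩ h
      by_contra h0
      have h4 : ‖u‖ ≤ B := not_lt.1 fun h => h0 (by simp only [hB u h, zero_mul])
      have h5 : ‖u + t‖ ≤ A := not_lt.1 fun h => h0 (by simp only [hA _ h, mul_zero])
      have h6 : ‖t‖ ≤ ‖u + t‖ + ‖u‖ := by
        simpa using norm_sub_le (u + t) u
      have := le_abs_self A
      have := le_abs_self B
      have := abs_nonneg A
      rcases h with h | h <;> simp only at h <;> linarith
  · rintro ⟨w, t⟩ h
    by_contra h0
    have h4 : ‖w - t‖ ≤ B := not_lt.1 fun h => h0 (by simp only [hB _ h, zero_mul])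
    have h5 : ‖w‖ ≤ A := not_lt.1 fun h => h0 (by simp only [hA _ h, mul_zero])
    have h6 : ‖t‖ ≤ ‖w‖ + ‖w - t‖ := by
      simpa using norm_sub_le w (w - t)
    have := le_abs_self A
    have := le_abs_self B
    have := abs_nonneg B
    rcases h with h | h <;> simp only at h <;> linarith

theorem continuous_smulConv_cauchyKernel {g : ℂ → ℂ} (hg : Continuous g)
    (hgc : HasCompactSupport g) : Continuous (smulConv cauchyKernel g) :=
  hgc.continuous_convolution_right (ContinuousLinearMap.lsmul ℝ ℂ : ℂ →L[ℝ] ℂ →L[ℝ] ℂ)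
    locallyIntegrable_cauchyKernel hg

/-- Split the kernel at the unit circle: inside, it is integrable and g is bounded; outside, it is
bounded by 1 and g is integrable. -/
theorem exists_bound_smulConv_cauchyKernel {g : ℂ → ℂ} (hg : Continuous g)
    (hgc : HasCompactSupport g) : ∃ C, ∀ w, ‖smulConv cauchyKernel g w‖ ≤ C := by
  obtain ⟨M, hM⟩ := hg.bounded_above_of_compact_support hgc
  have hM0 : 0 ≤ M := (norm_nonneg _).trans (hM 0)
  let B : Set ℂ := Metric.closedBall 0 1
  have hB : MeasurableSet B := Metric.isClosed_closedBall.measurableSet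
  have h1 : Integrable (B.indicator fun t => ‖cauchyKernel t‖ * M) volume :=
    (integrable_indicator_iff hB).2 ((locallyIntegrable_cauchyKernel.integrableOn_isCompact
      (isCompact_closedBall 0 1)).norm.mul_const M)
  have hgi : Integrable g volume := hg.integrable_of_hasCompactSupport hgc
  refine ⟨(∫ t, B.indicator (fun t => ‖cauchyKernel t‖ * M) t) + ∫ t, ‖g t‖, fun w => ?_⟩
  have h2 : Integrable (fun t => ‖g (w - t)‖) volume := (hgi.comp_sub_left w).norm
  rw [← integral_sub_left_eq_self (fun t => ‖g t‖) volume w, ← integral_add h1 h2]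
  refine norm_integral_le_of_norm_le (h1.add h2) (.of_forall fun t => ?_)
  rw [norm_smul]
  by_cases ht : t ∈ B
  · rw [Set.indicator_of_mem ht]
    have := mul_le_mul_of_nonneg_left (hM (w - t)) (norm_nonneg (cauchyKernel t))
    linarith [norm_nonneg (g (w - t))]
  · rw [Set.indicator_of_notMem ht, zero_add]
    refine mul_le_of_le_one_left (norm_nonneg _) ((norm_cauchyKernel_le t).trans ?_)
    rw [one_mul]
    exact inv_le_one_of_one_le₀ (not_le.1 fun h => ht (mem_closedBall_zero_iff.2 h)).le

/-- Write w = t + (w - t) under the integral. The kernel times t is bounded, and the factor w - t is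
absorbed in g, giving the bounded Cauchy transform of u g(u). This is the decay used at infinity. -/
theorem exists_bound_mul_smulConv_cauchyKernel {g : ℂ → ℂ} (hg : Continuous g)
    (hgc : HasCompactSupport g) : ∃ C, ∀ w, ‖w * smulConv cauchyKernel g w‖ ≤ C := by
  have hg1 : Continuous fun u => u * g u := continuous_id.mul hg
  have hg1c : HasCompactSupport fun u => u * g u := hgc.mul_left
  obtain ⟨C, hC⟩ := exists_bound_smulConv_cauchyKernel hg1 hg1c
  have hgi : Integrable g volume := hg.integrable_of_hasCompactSupport hgc
  refine ⟨(∫ t, ‖g t‖) + C, fun w => ?_⟩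
  have hkt : ∀ t, ‖cauchyKernel t * t‖ ≤ 1 := by
    intro t
    rw [norm_mul]
    refine (mul_le_mul_of_nonneg_right (norm_cauchyKernel_le t) (norm_nonneg t)).trans ?_
    rw [one_mul]
    exact inv_mul_le_one
  have hi : Integrable (fun t => cauchyKernel t • g (w - t)) volume :=
    integrable_smulConv locallyIntegrable_cauchyKernel hg hgc w
  have hi1 : Integrable (fun t => cauchyKernel t • ((w - t) * g (w - t))) volume :=
    integrable_smulConv locallyIntegrable_cauchyKernel hg1 hg1c w
  have hpt : ∀ t, cauchyKernel t * t * g (w - t) =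
      w * (cauchyKernel t • g (w - t)) - cauchyKernel t • ((w - t) * g (w - t)) := fun t => by
    simp only [smul_eq_mul]
    ring
  have heq : w * smulConv cauchyKernel g w = (∫ t, cauchyKernel t * t * g (w - t)) +
      smulConv cauchyKernel (fun u => u * g u) w := by
    simp only [hpt]
    rw [integral_sub (hi.const_mul w) hi1, integral_const_mul]
    simp only [smulConv]
    ring
  rw [heq]
  refine (norm_add_le _ _).trans (add_le_add ?_ (hC w))
  rw [← integral_sub_left_eq_self (fun t => ‖g t‖) volume w]
  refine norm_integral_le_of_norm_le (hgi.comp_sub_left w).norm (.of_forall fun t => ?_)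
  rw [norm_mul]
  exact mul_le_of_le_one_left (norm_nonneg _) (hkt t)

/-- A compactly supported distribution `a` on the complex plane can be written as `∂s/∂z̄`, where
`s` is the sum of a compactly supported distribution and of a function of size `O(1 / |z|)`. The
sign is such that `s (∂φ/∂z̄) = a φ`. -/
theorem exists_wirtingerBar_primitive (a : 𝓓((⊤ : Opens ℂ), ℂ) →L[ℂ] ℂ) {L : Set ℂ}
    (hL : IsCompact L) (ha : ∀ φ : 𝓓((⊤ : Opens ℂ), ℂ), Disjoint (tsupport φ) L → a φ = 0) :
    ∃ (s : 𝓓((⊤ : Opens ℂ), ℂ) →L[ℂ] ℂ) (h : ℂ → ℂ),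
      (∃ L' : Set ℂ, IsCompact L' ∧ ∀ φ : 𝓓((⊤ : Opens ℂ), ℂ), Disjoint (tsupport φ) L' → s φ = 0) ∧
      Continuous h ∧ (∃ C, ∀ w, ‖w * h w‖ ≤ C) ∧
      ∀ φ ψ : 𝓓((⊤ : Opens ℂ), ℂ), (∀ z, ψ z = wirtingerBar φ z) →
        s ψ + ∫ w, h w * ψ w = a φ := by
  obtain ⟨κ, g, hκ, hκs, hg, hgs, hκg⟩ := exists_parametrix one_pos
  have hball := isCompact_closedBall (0 : ℂ) 1
  have hκc : HasCompactSupport κ := .of_support_subset_isCompact hball ((subset_tsupport _).trans hκs)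
  have hgc : HasCompactSupport g := .of_support_subset_isCompact hball ((subset_tsupport _).trans hgs)
  obtain ⟨B, hB⟩ := exists_smulConvCLM hκ hκc
  let L' : Set ℂ := L + Metric.closedBall (0 : ℂ) 1
  have hL' : IsCompact L' := hL.add hball
  have hts : ∀ w, tsupport (fun z => g (z - w)) ⊆ {z | z - w ∈ Metric.closedBall (0 : ℂ) 1} := by
    intro w
    have hcl : IsClosed {z : ℂ | z - w ∈ Metric.closedBall (0 : ℂ) 1} :=
      Metric.isClosed_closedBall.preimage (continuous_id.sub continuous_const)
    exact closure_minimal (fun z hz => hgs (subset_tsupport _ hz)) hcl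
  let sh : ℂ → 𝓓((⊤ : Opens ℂ), ℂ) := fun w => ⟨fun z => g (z - w),
    hg.comp (contDiff_id.sub contDiff_const), hgc.comp_homeomorph (Homeomorph.subRight w),
    fun _ _ => trivial⟩
  let g₀ : ℂ → ℂ := fun w => a (sh w)
  have hball_sub : ∀ R : ℝ, ((⟨Metric.closedBall 0 R, isCompact_closedBall 0 R⟩ : Compacts ℂ) : Set ℂ)
      ⊆ (⊤ : Opens ℂ) := fun R _ _ => trivial
  -- Mollification is available for functions supported in a fixed ball. As g lives in the unit
  -- ball, the function obtained for radius R agrees with g₀ where ‖w‖ ≤ R - 1, which suffices for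
  -- the continuity of g₀.
  choose f hf hfw hfT using fun R : ℝ => exists_mollification
    (a ∘L TestFunction.ofSupportedInCLM ℂ (hball_sub R)) hg hgc
  have hfg : ∀ R w, ‖w‖ + 1 ≤ R → f R w = g₀ w := by
    intro R w hw
    refine (hfw R w (.of_support_subset (f := sh w) (sh w).contDiff fun z hz => ?_)
      fun z => rfl).symm
    have h1 : ‖z - w‖ ≤ 1 := mem_closedBall_zero_iff.1 (hts w (subset_tsupport _ hz))
    refine mem_closedBall_zero_iff.2 ?_
    have := norm_add_le (z - w) w
    rw [sub_add_cancel] at this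
    linarith
  have hg₀ : Continuous g₀ := by
    rw [continuous_iff_continuousAt]
    intro w
    refine (hf (‖w‖ + 2)).continuous.continuousAt.congr ?_
    filter_upwards [Metric.ball_mem_nhds w one_pos] with v hv
    refine hfg _ _ ?_
    have h1 : ‖v - w‖ < 1 := by rwa [← dist_eq_norm]
    have := norm_add_le (v - w) w
    rw [sub_add_cancel] at this
    linarith
  have hg₀c : HasCompactSupport g₀ := by
    refine HasCompactSupport.intro hL' fun w hw => ha _ ?_
    rw [Set.disjoint_left]
    intro z hz hzL
    refine hw ⟨z, hzL, w - z, ?_, by ring⟩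
    have := hts w hz
    simpa [norm_sub_rev] using this
  -- Applied to ∂φ/∂z̄, the first summand gives a φ - ∫ g₀ φ. The Cauchy transform of g₀ gives -∫ g₀
  -- φ, hence the sign that makes the errors cancel.
  refine ⟨a ∘L B, fun w => -smulConv cauchyKernel g₀ w, ⟨L', hL', fun φ hφ => ha _ ?_⟩,
    (continuous_smulConv_cauchyKernel hg₀ hg₀c).neg, ?_, fun φ ψ hψ => ?_⟩
  · change Disjoint (tsupport (B φ)) L
    rw [show (B φ : ℂ → ℂ) = smulConv κ φ from funext (hB φ), Set.disjoint_left]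
    intro z hz hzL
    obtain ⟨t, ht, s, hs, rfl⟩ := tsupport_smulConv_subset hκs subset_rfl hball
      φ.hasCompactSupport hz
    refine Set.disjoint_left.1 hφ hs ⟨t + s, hzL, -t, ?_, by simp⟩
    simpa using ht
  · obtain ⟨C, hC⟩ := exists_bound_mul_smulConv_cauchyKernel hg₀ hg₀c
    refine ⟨C, fun w => ?_⟩
    rw [mul_neg, norm_neg]
    exact hC w
  · have hψ' : (ψ : ℂ → ℂ) = wirtingerBar φ := funext hψ
    have h1 : ∫ w, -smulConv cauchyKernel g₀ w * ψ w = ∫ w, φ w * g₀ w := by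
      have h := integral_smulConv_cauchyKernel_mul_wirtingerBar hg₀ hg₀c
        (φ.contDiff.of_le (by simp)) φ.hasCompactSupport
      simp only [hψ', neg_mul, integral_neg, h, neg_neg]
      simp only [mul_comm]
    obtain ⟨R, hR⟩ := φ.hasCompactSupport.isCompact.isBounded.exists_norm_le
    let G : 𝓓_{⟨Metric.closedBall 0 (R + 1), isCompact_closedBall 0 (R + 1)⟩}(ℂ, ℂ) :=
      .of_support_subset (f := smulConv φ g) (contDiff_smulConv
        φ.continuous.locallyIntegrable hg hgc) (by
        refine (subset_tsupport _).trans ((tsupport_smulConv_subset subset_rfl hgs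
          φ.hasCompactSupport hball).trans ?_)
        rintro _ ⟨t, ht, s, hs, rfl⟩
        refine mem_closedBall_zero_iff.2 ((norm_add_le t s).trans ?_)
        exact add_le_add (hR t ht) (mem_closedBall_zero_iff.1 hs))
    have h2 := hfT (R + 1) φ φ.continuous φ.hasCompactSupport G fun z => rfl
    have h3 : ∫ w, φ w * f (R + 1) w = ∫ w, φ w * g₀ w := by
      refine integral_congr_ae (.of_forall fun w => ?_)
      by_cases hw : w ∈ tsupport φ
      · simp only [hfg (R + 1) w (by linarith [hR w hw])]
      · simp only [image_eq_zero_of_notMem_tsupport hw, zero_mul]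
    have h4 : B ψ = φ - TestFunction.ofSupportedIn (hball_sub (R + 1)) G := by
      ext z
      rw [hB, hψ', hκg φ φ.contDiff φ.hasCompactSupport, smulConv_comm]
      rfl
    change a (B ψ) + _ = _
    rw [h4, map_sub, h1, ← h3, ← h2]
    exact sub_add_cancel _ _

end CauchyTransform

/-! ### Holomorphic changes of variables -/

section ChangeOfVariables

open MeasureTheory Complex

/-- The real determinant of multiplication by a is the norm of a in the extension ℂ/ℝ. -/
theorem det_restrictScalars_toSpanSingleton (a : ℂ) :
    ((ContinuousLinearMap.toSpanSingleton ℂ a).restrictScalars ℝ : ℂ →L[ℝ] ℂ).det = normSq a := by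
  rw [← Algebra.norm_complex_apply, Algebra.norm_apply, ContinuousLinearMap.det]
  congr 1
  ext z
  simp [mul_comm]

/-- Change of variables along a holomorphic bijection. -/
theorem integral_image_of_hasDerivAt {s : Set ℂ} (hs : MeasurableSet s) {σ σ' : ℂ → ℂ}
    (hσ : ∀ z ∈ s, HasDerivAt σ (σ' z) z) (hinj : Set.InjOn σ s) (g : ℂ → ℂ) :
    ∫ w in σ '' s, g w = ∫ z in s, (normSq (σ' z) : ℂ) * g (σ z) := by
  rw [integral_image_eq_integral_abs_det_fderiv_smul volume hs
    (fun z hz => ((hσ z hz).hasFDerivAt.restrictScalars ℝ).hasFDerivWithinAt) hinj]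
  simp only [det_restrictScalars_toSpanSingleton, abs_of_nonneg (normSq_nonneg _), real_smul]

/-- Used to pass from one base vector to another in `IsGivenBy`. -/
theorem integral_normSq_mul_comp_mul_right {a : ℂ} (ha : a ≠ 0) (g : ℂ → ℂ) :
    ∫ w, (normSq a : ℂ) * g (w * a) = ∫ w, g w := by
  have h := integral_image_of_hasDerivAt MeasurableSet.univ (σ := fun w => w * a) (σ' := fun _ => a)
    (fun z _ => by simpa using (hasDerivAt_id z).mul_const a)
    (fun x _ y _ h => mul_right_cancel₀ ha h) g
  rw [Set.image_univ_of_surjective fun w => ⟨w / a, div_mul_cancel₀ w ha⟩] at h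
  simpa using h.symm

/-- The inversion has Jacobian |w|⁻⁴ and the origin is a null set. This moves integrals between V
and the chart at infinity. -/
theorem integral_comp_inv (g : ℂ → ℂ) :
    ∫ w, ((normSq w)⁻¹ ^ 2 : ℝ) * g w⁻¹ = ∫ w, g w := by
  have hs : MeasurableSet ({0}ᶜ : Set ℂ) := (measurableSet_singleton 0).compl
  have h := integral_image_of_hasDerivAt hs (σ := fun w => w⁻¹) (σ' := fun w => -(w ^ 2)⁻¹)
    (fun z hz => hasDerivAt_inv hz) inv_injective.injOn g
  have himg : (fun w : ℂ => w⁻¹) '' {0}ᶜ = {0}ᶜ := by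
    rw [Set.image_inv_eq_inv]
    ext w
    simp
  have hr : (volume : Measure ℂ).restrict {0}ᶜ = volume := by
    rw [Measure.restrict_eq_self_of_ae_mem]
    exact Measure.ae_ne volume 0
  rw [himg, hr] at h
  rw [h]
  simp [map_inv₀]

theorem exists_integralCLM (Ω : Opens ℂ) {h : ℂ → ℂ} (hh : LocallyIntegrable h volume) :
    ∃ I : 𝓓(Ω, ℂ) →L[ℂ] ℂ, ∀ ψ : 𝓓(Ω, ℂ), I ψ = ∫ w, h w * ψ w := by
  refine ⟨TestFunction.integralAgainstBilinCLM (ContinuousLinearMap.mul ℂ ℂ) volume h, fun ψ => ?_⟩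
  rw [TestFunction.integralAgainstBilinCLM_eq_integral (hh.locallyIntegrableOn _)]
  simp only [ContinuousLinearMap.mul_apply', mul_comm]

/-- Stokes for f φ, which is C¹ on the whole plane since φ vanishes near every point outside its
support, and whose Wirtinger derivative is f ∂φ/∂z̄. -/
theorem integral_mul_wirtingerBar_eq_zero_of_differentiableOn {Ω : Opens ℂ} {f : ℂ → ℂ}
    (hf : DifferentiableOn ℂ f Ω) (φ : 𝓓(Ω, ℂ)) : ∫ w, f w * wirtingerBar φ w = 0 := by
  have hφd : ContDiff ℝ 1 φ := φ.contDiff.of_le (by simp)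
  have hc : ContDiff ℝ 1 fun w => f w * φ w := by
    rw [contDiff_iff_contDiffAt]
    intro w
    by_cases hw : w ∈ tsupport φ
    · have h1 : ContDiffAt ℂ 1 f w :=
        (hf.contDiffOn Ω.isOpen).contDiffAt (Ω.isOpen.mem_nhds (φ.tsupport_subset hw))
      exact (h1.restrict_scalars ℝ).mul hφd.contDiffAt
    · refine (contDiffAt_const (c := (0 : ℂ))).congr_of_eventuallyEq ?_
      filter_upwards [notMem_tsupport_iff_eventuallyEq.1 hw] with z hz
      simp [hz]
  rw [← integral_wirtingerBar_eq_zero hc φ.hasCompactSupport.mul_left]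
  refine integral_congr_ae (.of_forall fun w => ?_)
  simp only
  by_cases hw : w ∈ tsupport φ
  · have h1 : DifferentiableAt ℂ f w :=
      hf.differentiableAt (Ω.isOpen.mem_nhds (φ.tsupport_subset hw))
    rw [wirtingerBar_mul (h1.restrictScalars ℝ) (hφd.differentiable one_ne_zero w),
      wirtingerBar_of_differentiableAt h1, zero_mul, zero_add]
  · rw [image_eq_zero_of_notMem_tsupport fun h => hw (tsupport_wirtingerBar_subset _ h),
      image_eq_zero_of_notMem_tsupport fun h =>
        hw (tsupport_mul_subset_right (tsupport_wirtingerBar_subset _ h)), mul_zero]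

end ChangeOfVariables

/-! ### Linear coordinates on a complex line -/

section Coordinates

open Complex

variable {E F G : Type*} [NormedAddCommGroup E] [NormedSpace ℂ E] [NormedAddCommGroup F]
  [NormedSpace ℂ F] [NormedAddCommGroup G] [NormedSpace ℂ G]

/-- The antilinear functional `v ↦ conj (c v)`. -/
def conjFunctional (c : StrongDual ℂ E) : E →L⋆[ℂ] ℂ :=
  ((starL ℂ : ℂ ≃L⋆[ℂ] ℂ) : ℂ →L⋆[ℂ] ℂ).comp c

@[simp]
theorem conjFunctional_apply (c : StrongDual ℂ E) (v : E) :
    conjFunctional c v = (starRingEnd ℂ) (c v) := rfl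

theorem exists_coordinate (hE : Module.finrank ℂ E = 1) :
    ∃ (b : E) (c : StrongDual ℂ E), c b = 1 ∧ ∀ v, c v • b = v := by
  have : FiniteDimensional ℂ E := .of_finrank_pos (by omega)
  obtain ⟨b, hb, h⟩ := finrank_eq_one_iff'.1 hE
  have hinj := smul_left_injective ℂ hb
  choose c hc using h
  let c' : E →ₗ[ℂ] ℂ :=
    { toFun := c
      map_add' := fun x y => hinj (by simp only [add_smul, hc])
      map_smul' := fun r x => hinj (by simp only [smul_eq_mul, mul_smul, hc, RingHom.id_apply]) }
  exact ⟨b, c'.toContinuousLinearMap, hinj (by simp [c', hc]), hc⟩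

/-- Transport of test functions from the complex plane to a complex line. -/
theorem exists_toLineCLM {b : E} {c : StrongDual ℂ E} (hc : ∀ v, c v • b = v) {U : Opens E}
    {Ω : Opens ℂ} (hΩ : ∀ w, w ∈ Ω → w • b ∈ U) (A : F →L[ℂ] G) :
    ∃ B : 𝓓(Ω, F) →L[ℂ] 𝓓(U, G), ∀ φ v, B φ v = A (φ (c v)) := by
  obtain ⟨B, hB⟩ := exists_pullback_postcompCLM (Ω := Ω) (U := U) (fun _ => 1) c A fun K hK hKΩ =>
    ⟨(fun w : ℂ => w • b) '' K, hK.image (by fun_prop), by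
      rintro _ ⟨w, hw, rfl⟩
      exact hΩ w (hKΩ hw), ⟨Set.univ, isOpen_univ, Set.subset_univ _, contDiffOn_const,
        (c.restrictScalars ℝ).contDiff.contDiffOn⟩, fun z _ hz => ⟨c z, hz, hc z⟩⟩
  exact ⟨B, fun φ v => by rw [hB, one_smul]⟩

/-- Transport of test functions from a complex line to the complex plane. -/
theorem exists_toPlaneCLM {b : E} (hb : b ≠ 0) {U : Opens E} {Ω : Opens ℂ}
    (hΩ : ∀ w, w • b ∈ U → w ∈ Ω) (A : F →L[ℂ] G) :
    ∃ B : 𝓓(U, F) →L[ℂ] 𝓓(Ω, G), ∀ ψ w, B ψ w = A (ψ (w • b)) := by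
  obtain ⟨B, hB⟩ := exists_pullback_postcompCLM (Ω := U) (U := Ω) (fun _ => 1)
    (fun w : ℂ => w • b) A fun K hK hKU =>
    ⟨(fun w : ℂ => w • b) ⁻¹' K, (isClosedEmbedding_smul_left hb).isCompact_preimage hK,
      fun w hw => hΩ w (hKU hw), ⟨Set.univ, isOpen_univ, Set.subset_univ _, contDiffOn_const,
        (contDiff_id.smul contDiff_const).contDiffOn⟩, fun z _ hz => hz⟩
  exact ⟨B, fun φ v => by rw [hB, one_smul]⟩

/-- This is ∂̄φ = (∂φ/∂w̄) dw̄, the conjugate of c u being the value of dw̄ at u; it carries the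
planar results over to V. -/
theorem dbarTest_eq_wirtingerBar {b : E} {c : StrongDual ℂ E} (hc : ∀ v, c v • b = v) (U : Opens E)
    (φ : 𝓓(U, ℂ)) (w : ℂ) (u : E) :
    dbarTest U φ (w • b) u = (starRingEnd ℂ) (c u) * wirtingerBar (fun z => φ (z • b)) w := by
  have h1 : HasFDerivAt (fun z : ℂ => z • b)
      ((ContinuousLinearMap.toSpanSingleton ℂ b).restrictScalars ℝ) w :=
    ((ContinuousLinearMap.toSpanSingleton ℂ b).restrictScalars ℝ).hasFDerivAt
  have h2 : HasFDerivAt φ (fderiv ℝ φ (w • b)) (w • b) :=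
    ((φ.contDiff.differentiable (by simp)) _).hasFDerivAt
  have h3 := (h2.comp w h1).fderiv
  conv_lhs => rw [← hc u]
  rw [ContinuousLinearMap.map_smulₛₗ, dbarTest_apply, wirtingerBar,
    show (fun z : ℂ => φ (z • b)) = φ ∘ fun z : ℂ => z • b from rfl, h3]
  simp

/-- The preimage of `U` under the parametrization `w ↦ w • b`. -/
def coordOpens (b : E) (U : Opens E) : Opens ℂ :=
  ⟨(fun w : ℂ => w • b) ⁻¹' U, U.isOpen.preimage (by fun_prop)⟩

/-- Evaluation of antilinear functionals at a vector. -/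
abbrev evalAt (b : E) : (E →L⋆[ℂ] ℂ) →L[ℂ] ℂ := ContinuousLinearMap.apply' ℂ (starRingEnd ℂ) b

end Coordinates

/-! ### Holomorphic forms on V: closedness, Weyl's lemma, identity theorem -/

section Holomorphic

open MeasureTheory Complex

variable {V : Type*} [NormedAddCommGroup V] [NormedSpace ℂ V]

theorem differentiableOn_coord {U : Opens V} {f : V → StrongDual ℂ V}
    (hf : DifferentiableOn ℂ f U) (b : V) :
    DifferentiableOn ℂ (fun w : ℂ => f (w • b) b) (coordOpens b U) := by
  have h1 : DifferentiableOn ℂ (fun w : ℂ => f (w • b)) (coordOpens b U) :=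
    hf.comp (differentiable_id.smul_const b).differentiableOn fun w hw => hw
  exact h1.clm_apply (differentiableOn_const b)

/-- Holomorphic forms are `∂̄`-closed. -/
theorem dbar_eq_zero_of_mem_Omega (hV : Module.finrank ℂ V = 1) {U : Opens V} {ω : Db10 U}
    (hω : ω ∈ Omega U) : dbar U ω = 0 := by
  obtain ⟨b, c, hcb, hc⟩ := exists_coordinate hV
  have hb : b ≠ 0 := fun h => by simp [h] at hcb
  obtain ⟨f, hf, hω⟩ := hω
  obtain ⟨B, hB⟩ := exists_toPlaneCLM hb (U := U) (Ω := coordOpens b U) (fun w hw => hw)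
    (ContinuousLinearMap.id ℂ ℂ)
  ext φ
  change ω (dbarTest U φ) = 0
  have h1 := integral_mul_wirtingerBar_eq_zero_of_differentiableOn (differentiableOn_coord hf b)
    (B φ)
  have h2 : (B φ : ℂ → ℂ) = fun w => φ (w • b) := funext (hB φ)
  rw [hω b hb]
  simp only [dbarTest_eq_wirtingerBar hc, hcb, map_one, one_mul]
  rw [integral_const_mul, ← h2, h1, mul_zero]

/-- Weyl's lemma: `∂̄`-closed distributional forms of type `(1,0)` are holomorphic. -/
theorem mem_Omega_of_dbar_eq_zero (hV : Module.finrank ℂ V = 1) {U : Opens V} {T : Db10 U}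
    (hT : dbar U T = 0) : T ∈ Omega U := by
  obtain ⟨b, c, hcb, hc⟩ := exists_coordinate hV
  have hb : b ≠ 0 := fun h => by simp [h] at hcb
  -- The operator sends a planar test function φ to the test form φ dw̄.
  obtain ⟨toV, htoV⟩ := exists_toLineCLM hc (U := U) (Ω := coordOpens b U) (fun w hw => hw)
    (ContinuousLinearMap.toSpanSingleton ℂ (conjFunctional c))
  obtain ⟨toV0, htoV0⟩ := exists_toLineCLM hc (U := U) (Ω := coordOpens b U) (fun w hw => hw)
    (ContinuousLinearMap.id ℂ ℂ)
  obtain ⟨toC, htoC⟩ := exists_toPlaneCLM hb (U := U) (Ω := coordOpens b U) (fun w hw => hw)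
    (evalAt b)
  obtain ⟨f, hf, hTf⟩ := exists_holomorphic_of_wirtingerBar_eq_zero (T ∘L toV) fun φ ψ hψ => by
    have h1 : toV ψ = dbarTest U (toV0 φ) := by
      ext v u
      have h2 := dbarTest_eq_wirtingerBar hc U (toV0 φ) (c v) u
      have h3 : (fun z : ℂ => toV0 φ (z • b)) = φ := by
        funext z
        rw [htoV0]
        simp [hcb]
      rw [hc, h3, ← hψ] at h2
      rw [h2, htoV]
      simp [mul_comm]
    change T (toV ψ) = 0
    rw [h1]
    exact congrArg (fun S : Db11 U => S (toV0 φ)) hT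
  -- The constant undoes the factor -2i from dw ∧ dw̄ in `IsGivenBy`.
  refine ⟨fun v => ((-2 * I)⁻¹ * f (c v)) • c, ?_, fun b' hb' ψ => ?_⟩
  · have h1 : DifferentiableOn ℂ (fun v => f (c v)) U :=
      hf.comp c.differentiable.differentiableOn fun v hv => by
        change c v • b ∈ U
        rwa [hc]
    exact (h1.const_mul _).smul_const c
  · have hψ : toV (toC ψ) = ψ := by
      ext v u
      rw [htoV, htoC]
      simp only [ContinuousLinearMap.toSpanSingleton_apply, evalAt,
        ContinuousLinearMap.apply_apply', smul_apply, conjFunctional_apply, hc, smul_eq_mul]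
      conv_rhs => rw [← hc u, ContinuousLinearMap.map_smulₛₗ]
      rw [smul_eq_mul, mul_comm]
    have h0 : c b' ≠ 0 := fun h => hb' (by rw [← hc b', h, zero_smul])
    have h1 : T ψ = ∫ w, f w * toC ψ w := by
      rw [← hTf]
      exact congrArg T hψ.symm
    rw [h1, ← integral_normSq_mul_comp_mul_right h0]
    refine integral_congr_ae (.of_forall fun w => ?_)
    have h2 : ψ (w • b') b' = (starRingEnd ℂ) (c b') * ψ (w • b') b := by
      conv_lhs => enter [2]; rw [← hc b']
      rw [ContinuousLinearMap.map_smulₛₗ, smul_eq_mul]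
    have h3 : (w * c b') • b = w • b' := by rw [mul_smul, hc]
    simp only [htoC, h3, h2, evalAt, ContinuousLinearMap.apply_apply', map_smul, smul_apply,
      smul_eq_mul, normSq_eq_conj_mul_self]
    have hI : (-2 * I : ℂ) ≠ 0 := by simp
    field_simp

/-- A holomorphic form that vanishes on a nonempty open set vanishes. -/
theorem eq_zero_of_restr_eq_zero (hV : Module.finrank ℂ V = 1) {U : Opens V}
    (hU : (U : Set V).Nonempty) {η : Db10 (⊤ : Opens V)} (hη : η ∈ Omega ⊤)
    (h : restr U η = 0) : η = 0 := by
  obtain ⟨b, c, hcb, hc⟩ := exists_coordinate hV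
  have hb : b ≠ 0 := fun h => by simp [h] at hcb
  obtain ⟨f, hf, hη⟩ := hη
  obtain ⟨toV, htoV⟩ := exists_toLineCLM hc (U := U) (Ω := coordOpens b U) (fun w hw => hw)
    (ContinuousLinearMap.toSpanSingleton ℂ (conjFunctional c))
  have hd : Differentiable ℂ fun w : ℂ => f (w • b) b := by
    rw [← differentiableOn_univ]
    exact differentiableOn_coord hf b
  have hI : (-2 * I : ℂ) ≠ 0 := by simp
  have h1 : Set.EqOn (fun w : ℂ => f (w • b) b) 0 (coordOpens b U) := by
    refine eqOn_zero_of_integral_mul_eq_zero (coordOpens b U).isOpen hd.continuous.continuousOn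
      fun ψ hψ hψc hψO => ?_
    have h2 : η (TestFunction.monoCLM ℂ (toV ⟨ψ, hψ, hψc, hψO⟩)) = 0 :=
      congrArg (fun S : Db10 U => S (toV ⟨ψ, hψ, hψc, hψO⟩)) h
    rw [hη b hb, integral_const_mul] at h2
    refine Eq.trans ?_ ((mul_eq_zero.1 h2).resolve_left hI)
    refine integral_congr_ae (.of_forall fun w => ?_)
    simp only [monoCLM_apply_apply, htoV]
    simp [hcb]
  obtain ⟨v, hv⟩ := hU
  have h3 : (fun w : ℂ => f (w • b) b) = 0 := by
    refine AnalyticOnNhd.eq_of_eventuallyEq (z₀ := c v)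
      (hd.differentiableOn.analyticOnNhd isOpen_univ) analyticOnNhd_const ?_
    filter_upwards [(coordOpens b U).isOpen.mem_nhds (x := c v) (by
      change c v • b ∈ U
      rwa [hc])] with w hw
    exact h1 hw
  ext ψ
  rw [hη b hb]
  simp only [congrFun h3]
  simp

end Holomorphic

/-! ### Extension across the point at infinity and the ∂̄-equation -/

section Infinity

open MeasureTheory Complex

variable {V : Type*} [NormedAddCommGroup V] [NormedSpace ℂ V]

theorem restr_top {W : Type*} [NormedAddCommGroup W] [NormedSpace ℂ W] {F : Type*}
    [NormedAddCommGroup F] [NormedSpace ℂ F] (T : Current (⊤ : Opens W) F) : restr ⊤ T = T := by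
  ext φ
  rw [restr_apply]
  congr 1
  ext z : 1
  exact monoCLM_apply_apply ⊤ φ z

theorem mem_DbT10_top {S : Db10 (⊤ : Opens V)} (S' : Db10 (⊤ : Opens (StrongDual ℂ V)))
    (h : (S, S') ∈ DbP10 V) : S ∈ DbT10 (⊤ : Opens V) :=
  ⟨(S, S'), h, restr_top S⟩

/-- A current that vanishes on the complement of a compact set kills every test form whose support
does not meet this set. -/
theorem apply_eq_zero_of_restr_eq_zero {F : Type*} [NormedAddCommGroup F] [NormedSpace ℂ F]
    {U : Opens V} {T : Current (⊤ : Opens V) F} (hT : restr U T = 0) (φ : 𝓓((⊤ : Opens V), F))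
    (hφ : Disjoint (tsupport φ) (U : Set V)ᶜ) : T φ = 0 := by
  let φ' : 𝓓(U, F) := ⟨φ, φ.contDiff, φ.hasCompactSupport, Set.disjoint_compl_right_iff_subset.1 hφ⟩
  have h : TestFunction.monoCLM ℂ φ' = φ := by
    ext z : 1
    exact monoCLM_apply_apply U φ' z
  rw [← h]
  exact congrArg (fun S : Current U F => S φ') hT

/-- Compactly supported distributional forms extend by zero to the point at infinity. -/
theorem mem_DbT10_of_compact_support (hV : Module.finrank ℂ V = 1) {S : Db10 (⊤ : Opens V)}
    {L : Set V} (hL : IsCompact L)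
    (hS : ∀ φ : 𝓓((⊤ : Opens V), V →L⋆[ℂ] ℂ), Disjoint (tsupport φ) L → S φ = 0) :
    S ∈ DbT10 (⊤ : Opens V) := by
  have : FiniteDimensional ℂ V := .of_finrank_pos (by omega)
  have : FiniteDimensional ℝ V := FiniteDimensional.complexToReal V
  obtain ⟨b, c, hcb, hc⟩ := exists_coordinate hV
  have hc0 : c ≠ 0 := fun h => by simp [h] at hcb
  obtain ⟨R, hR⟩ := hL.isBounded.exists_norm_le
  -- The cut-off is 1 on a neighbourhood of L; the absolute value covers a negative R, possible when
  -- L is empty.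
  let χ : ContDiffBump (0 : V) := ⟨|R| + 1, |R| + 2, by positivity, by linarith⟩
  have hχ : ContDiff ℝ (⊤ : ℕ∞) fun z => (χ z : ℂ) := ofRealCLM.contDiff.comp χ.contDiff
  have hχc : HasCompactSupport χ := χ.hasCompactSupport
  have hO : IsOpen {z : V | c z ≠ 0} := isOpen_ne.preimage c.continuous
  have hcR : ContDiff ℝ (⊤ : ℕ∞) fun z : V => c z := (c.restrictScalars ℝ).contDiff
  -- B ψ is χ times the pull-back of ψ along z ↦ ζ = (c z)⁻¹ c. As -(ζ v) ζ = -(c v)(c z)⁻² c and ψ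
  -- has antilinear values, the conjugate of this factor appears.
  obtain ⟨B, hB⟩ := exists_pullback_postcompCLM (Ω := (⊤ : Opens (StrongDual ℂ V)))
    (U := (⊤ : Opens V)) (fun z => (χ z : ℂ) * -((starRingEnd ℂ) (c z)⁻¹) ^ 2)
    (fun z => (c z)⁻¹ • c)
    (ContinuousLinearMap.toSpanSingleton ℂ (conjFunctional c) ∘L evalAt c) fun K hK _ => by
      obtain ⟨R', hR'⟩ := hK.isBounded.exists_norm_le
      -- A bound on ζ in the chart at infinity keeps z away from the origin, where the change of
      -- charts is singular.
      refine ⟨tsupport χ ∩ {z | ‖c‖ ≤ R' * ‖c z‖}, hχc.isCompact.inter_right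
        (isClosed_le continuous_const (by fun_prop)), fun _ _ => trivial,
        ⟨{z | c z ≠ 0}, hO, fun z hz h0 => ?_, ?_, ?_⟩, fun z hz hzK => ?_⟩
      · have : ‖c‖ ≤ R' * ‖c z‖ := hz.2
        rw [h0, norm_zero, mul_zero] at this
        exact hc0 (norm_le_zero_iff.1 this)
      · have hinv : ContDiffOn ℝ (⊤ : ℕ∞) (fun z : V => (c z)⁻¹) {z | c z ≠ 0} :=
          hcR.contDiffOn.inv fun z hz => hz
        exact hχ.contDiffOn.mul ((conjCLE.contDiff.comp_contDiffOn hinv).pow 2).neg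
      · have hinv : ContDiffOn ℝ (⊤ : ℕ∞) (fun z : V => (c z)⁻¹) {z | c z ≠ 0} :=
          hcR.contDiffOn.inv fun z hz => hz
        exact hinv.smul contDiffOn_const
      · have hz0 : c z ≠ 0 := fun h => hz (by simp [h])
        refine ⟨subset_tsupport _ fun h => hz (by simp [h]), ?_⟩
        have h := hR' _ hzK
        rw [norm_smul, norm_inv, inv_mul_le_iff₀ (norm_pos_iff.2 hz0)] at h
        rwa [Set.mem_ofPred_eq, mul_comm]
  -- The component of the extension at infinity is S ∘ B: for corresponding φ and ψ one has B ψ = χ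
  -- φ, and φ - χ φ vanishes near L.
  refine mem_DbT10_top (S ∘L B) fun φ ψ h0 _ h => ?_
  change S φ = S (B ψ)
  have hBφ : ∀ z, B ψ z = (χ z : ℂ) • φ z := by
    intro z
    ext v
    rw [hB]
    change ((χ z : ℂ) * -((starRingEnd ℂ) (c z)⁻¹) ^ 2) *
      (ψ ((c z)⁻¹ • c) c * (starRingEnd ℂ) (c v)) = (χ z : ℂ) * φ z v
    by_cases hz : c z = 0
    · have hz' : z = 0 := by rw [← hc z, hz, zero_smul]
      have : φ z = 0 := image_eq_zero_of_notMem_tsupport (hz' ▸ h0)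
      simp [this, hz]
    · have h1 := h z ((c z)⁻¹ • c) (by simp [hz]) v
      have h2 : -(((c z)⁻¹ • c) v) • (c z)⁻¹ • c = (-(c v * (c z)⁻¹ ^ 2)) • c := by
        rw [smul_smul]
        congr 1
        simp only [smul_apply, smul_eq_mul]
        ring
      rw [h2, ContinuousLinearMap.map_smulₛₗ] at h1
      rw [h1, smul_eq_mul, map_neg, map_mul, map_pow]
      ring
  rw [← sub_eq_zero, ← map_sub]
  refine hS _ ?_
  rw [Set.disjoint_left]
  intro z hz hzL
  refine notMem_tsupport_iff_eventuallyEq.2 ?_ hz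
  have hzR : z ∈ Metric.ball (0 : V) (|R| + 1) := by
    rw [mem_ball_zero_iff]
    linarith [hR z hzL, le_abs_self R]
  filter_upwards [Metric.isOpen_ball.mem_nhds hzR] with y hy
  have h1 : χ y = 1 := χ.one_of_mem_closedBall (Metric.ball_subset_closedBall hy)
  change φ y - B ψ y = 0
  rw [hBφ, h1, ofReal_one, one_smul, sub_self]

/-- A continuous function of size `O(1 / |w|)` on `V` defines a form of type `(1,0)` that extends to
the point at infinity. -/
theorem mem_DbT10_of_norm_mul_le (hV : Module.finrank ℂ V = 1) {b : V} (hb : b ≠ 0) {h : ℂ → ℂ}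
    (hh : Continuous h) {C : ℝ} (hC : ∀ w, ‖w * h w‖ ≤ C) {S : Db10 (⊤ : Opens V)}
    (hS : ∀ φ : 𝓓((⊤ : Opens V), V →L⋆[ℂ] ℂ), S φ = ∫ w : ℂ, h w * φ (w • b) b) :
    S ∈ DbT10 (⊤ : Opens V) := by
  obtain ⟨c, hcb⟩ : ∃ c : StrongDual ℂ V, c b = 1 := by
    obtain ⟨b', c', hcb', hc'⟩ := exists_coordinate hV
    have hn : c' b ≠ 0 := fun h => hb (by rw [← hc' b, h, zero_smul])
    exact ⟨(c' b)⁻¹ • c', by simp [hn]⟩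
  have hc0 : c ≠ 0 := fun h => by simp [h] at hcb
  -- The coefficient of h dw in the coordinate ζ = 1/w, where dw = -ζ⁻² dζ; the decay of h bounds it
  -- by C/|ζ|.
  have hH : LocallyIntegrable (fun ζ : ℂ => -h ζ⁻¹ * (ζ⁻¹) ^ 2) volume := by
    refine locallyIntegrable_of_norm_le_inv (C := C) (fun ζ => ?_)
      (((hh.measurable.comp measurable_inv).neg.mul
        (measurable_inv.pow_const 2)).aestronglyMeasurable)
    have h1 := mul_le_mul_of_nonneg_right (hC ζ⁻¹) (norm_nonneg ζ⁻¹)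
    rw [norm_inv ζ] at h1
    refine le_trans (le_of_eq ?_) h1
    rw [norm_mul, norm_neg, norm_mul, norm_pow, norm_inv]
    ring
  obtain ⟨I, hI⟩ := exists_integralCLM ⊤ hH
  obtain ⟨toC, htoC⟩ := exists_toPlaneCLM hc0 (U := ⊤) (Ω := ⊤) (fun _ _ => trivial) (evalAt c)
  refine mem_DbT10_top (I ∘L toC) fun φ ψ h0 _ hφψ => ?_
  change S φ = I (toC ψ)
  rw [hS, hI, ← integral_comp_inv]
  refine integral_congr_ae ?_
  filter_upwards [Measure.ae_ne volume (0 : ℂ)] with w hw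
  have h1 := hφψ (w⁻¹ • b) (w • c) (by simp [hcb, hw]) b
  have h2 : -((w • c) b) • w • c = (-w ^ 2) • c := by
    rw [smul_smul]
    congr 1
    simp [hcb, pow_two]
  rw [h2, ContinuousLinearMap.map_smulₛₗ, smul_eq_mul, map_neg, map_pow] at h1
  rw [h1, htoC]
  have hw' : (starRingEnd ℂ) w ≠ 0 := by simpa using hw
  simp only [evalAt, ContinuousLinearMap.apply_apply', ofReal_pow, ofReal_inv,
    normSq_eq_conj_mul_self]
  field_simp

/-- Every compactly supported distributional form of type `(1,1)` is `∂̄` of a tempered form. -/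
theorem exists_dbar_eq (hV : Module.finrank ℂ V = 1) {a : Db11 (⊤ : Opens V)} {L : Set V}
    (hL : IsCompact L) (ha : ∀ φ : 𝓓((⊤ : Opens V), ℂ), Disjoint (tsupport φ) L → a φ = 0) :
    ∃ s ∈ DbT10 (⊤ : Opens V), dbar ⊤ s = a := by
  obtain ⟨b, c, hcb, hc⟩ := exists_coordinate hV
  have hb : b ≠ 0 := fun h => by simp [h] at hcb
  obtain ⟨toV0, htoV0⟩ := exists_toLineCLM hc (U := ⊤) (Ω := ⊤) (fun _ _ => trivial)
    (ContinuousLinearMap.id ℂ ℂ)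
  obtain ⟨toC0, htoC0⟩ := exists_toPlaneCLM hb (U := ⊤) (Ω := ⊤) (fun _ _ => trivial)
    (ContinuousLinearMap.id ℂ ℂ)
  obtain ⟨toC, htoC⟩ := exists_toPlaneCLM hb (U := ⊤) (Ω := ⊤) (fun _ _ => trivial) (evalAt b)
  obtain ⟨s, h, ⟨L', hL', hs⟩, hh, ⟨C, hC⟩, hsh⟩ := exists_wirtingerBar_primitive (a ∘L toV0)
    (hL.image c.continuous) fun φ hφ => ha _ (by
      rw [Set.disjoint_left] at hφ ⊢
      intro z hz hzL
      refine hφ ?_ ⟨z, hzL, rfl⟩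
      have h1 : (toV0 φ : V → ℂ) = φ ∘ c := funext (htoV0 φ)
      change z ∈ tsupport (toV0 φ) at hz
      rw [h1] at hz
      exact tsupport_comp_subset_preimage _ c.continuous hz)
  obtain ⟨J, hJ⟩ := exists_integralCLM ⊤ hh.locallyIntegrable
  refine ⟨s ∘L toC + J ∘L toC, (DbT10 ⊤).add_mem
    (mem_DbT10_of_compact_support hV (hL'.image (f := fun w : ℂ => w • b) (by fun_prop))
      fun φ hφ => hs _ ?_)
    (mem_DbT10_of_norm_mul_le hV hb hh hC fun φ => ?_), ?_⟩
  · rw [Set.disjoint_left] at hφ ⊢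
    intro w hw hwL
    refine hφ ?_ ⟨w, hwL, rfl⟩
    have h1 : (toC φ : ℂ → ℂ) = evalAt b ∘ φ ∘ fun w : ℂ => w • b := funext (htoC φ)
    change w ∈ tsupport (toC φ) at hw
    rw [h1] at hw
    exact tsupport_comp_subset_preimage φ (f := fun w : ℂ => w • b) (by fun_prop)
      (tsupport_comp_subset (map_zero _) _ hw)
  · change J (toC φ) = _
    rw [hJ]
    simp only [htoC]
    rfl
  · ext φ
    change s (toC (dbarTest ⊤ φ)) + J (toC (dbarTest ⊤ φ)) = a φ
    have h1 : toV0 (toC0 φ) = φ := by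
      ext v
      rw [htoV0, htoC0]
      simp [hc]
    have h2 : (toC0 φ : ℂ → ℂ) = fun w => φ (w • b) := funext (htoC0 φ)
    rw [hJ, hsh (toC0 φ) (toC (dbarTest ⊤ φ)) fun w => by
      rw [htoC, h2]
      simp [dbarTest_eq_wirtingerBar hc, hcb]]
    exact congrArg a h1

end Infinity

/-! ### Isomorphisms of subquotients -/

section Subquotients

variable {M N : Type*} [AddCommGroup M] [Module ℂ M] [AddCommGroup N] [Module ℂ N]

theorem cls_eq_cls_iff {Z B : Submodule ℂ M} {x y : M} (hx : x ∈ Z) (hy : y ∈ Z) :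
    (cls x hx : Subquotient Z B) = cls y hy ↔ x - y ∈ B := by
  change (B.submoduleOf Z).mkQ _ = (B.submoduleOf Z).mkQ _ ↔ _
  rw [Submodule.mkQ_apply, Submodule.mkQ_apply, Submodule.Quotient.eq]
  rfl

/-- A linear map that induces a bijection between two subquotients induces an isomorphism. -/
theorem exists_subquotient_equiv {Z B : Submodule ℂ M} {Z' B' : Submodule ℂ N} (F : M →ₗ[ℂ] N)
    (hZ : ∀ x ∈ Z, F x ∈ Z') (hB : ∀ x ∈ Z, x ∈ B → F x ∈ B')
    (hinj : ∀ x ∈ Z, F x ∈ B' → x ∈ B) (hsurj : ∀ y ∈ Z', ∃ x ∈ Z, y - F x ∈ B') :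
    ∃ e : Subquotient Z B ≃ₗ[ℂ] Subquotient Z' B',
      ∀ x (hx : x ∈ Z), e (cls x hx) = cls (F x) (hZ x hx) := by
  let f : (Z ⧸ B.submoduleOf Z) →ₗ[ℂ] (Z' ⧸ B'.submoduleOf Z') :=
    (B.submoduleOf Z).mapQ (B'.submoduleOf Z') (F.restrict hZ) fun x hx => hB x x.2 hx
  have hf : Function.Bijective f := by
    constructor
    · rw [← LinearMap.ker_eq_bot, LinearMap.ker_eq_bot']
      intro q hq
      obtain ⟨x, rfl⟩ := Submodule.Quotient.mk_surjective _ q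
      refine (Submodule.Quotient.mk_eq_zero _).2 (hinj x x.2 ?_)
      exact (Submodule.Quotient.mk_eq_zero (B'.submoduleOf Z')).1 hq
    · intro q
      obtain ⟨y, rfl⟩ := Submodule.Quotient.mk_surjective _ q
      obtain ⟨x, hx, h⟩ := hsurj y y.2
      exact ⟨Submodule.Quotient.mk ⟨x, hx⟩, ((Submodule.Quotient.eq (B'.submoduleOf Z')).2 h).symm⟩
  exact ⟨LinearEquiv.ofBijective f hf, fun x hx => rfl⟩

end Subquotients

/-! ### The two descriptions of local cohomology -/

section LocalCohomology

variable {V : Type*} [NormedAddCommGroup V] [NormedSpace ℂ V]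

theorem mem_cocycles_iff {U : Opens V} {a : Db11 (⊤ : Opens V)} {b : Db10 U} :
    (a, b) ∈ cocycles U ↔ (a ∈ DbT11 ⊤ ∧ b ∈ DbT10 U) ∧ -restr U a + -dbar U b = 0 :=
  Iff.rfl

/-- Keep only the component on V of an extension to P. That tempered forms extend is what drives
both surjectivity arguments. -/
theorem exists_restr_eq {U : Opens V} {ω : Db10 U} (hω : ω ∈ DbT10 U) :
    ∃ R ∈ DbT10 (⊤ : Opens V), restr U R = ω := by
  obtain ⟨R, hR, rfl⟩ := hω
  exact ⟨R.1, mem_DbT10_top R.2 hR, rfl⟩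

theorem mem_cocycles_of_mem_Gamma11 {U : Opens V} {T : Db11 (⊤ : Opens V)} (hT : T ∈ Gamma11 U) :
    (T, (0 : Db10 U)) ∈ cocycles U := by
  refine mem_cocycles_iff.2 ⟨⟨hT.1, zero_mem _⟩, ?_⟩
  rw [show restr U T = 0 from hT.2, map_zero, neg_zero, add_zero]

/-- If s extends b, then (a, b) and (a + ∂̄s, 0) differ by the coboundary of -s, and the cocycle
condition says that a + ∂̄s vanishes on U. -/
theorem exists_gammaEquiv (U : Opens V) :
    ∃ Ψ : GammaQuot U ≃ₗ[ℂ] LocalH1 U, ∀ (T : Db11 (⊤ : Opens V)) (hT : T ∈ Gamma11 U),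
      Ψ (cls T hT) = cls (T, 0) (mem_cocycles_of_mem_Gamma11 hT) := by
  refine exists_subquotient_equiv (LinearMap.inl ℂ (Db11 (⊤ : Opens V)) (Db10 U))
    (fun T hT => mem_cocycles_of_mem_Gamma11 hT) ?_ ?_ ?_
  · rintro _ - ⟨s, hs, rfl⟩
    refine ⟨s, hs.1, Prod.ext rfl ?_⟩
    change -restr U s = 0
    rw [show restr U s = 0 from hs.2, neg_zero]
  · rintro T - ⟨s, hs, h⟩
    exact ⟨s, ⟨hs, neg_eq_zero.1 (congrArg Prod.snd h)⟩, congrArg Prod.fst h⟩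
  · rintro ⟨a, b⟩ hab
    obtain ⟨⟨ha, hb⟩, h⟩ := mem_cocycles_iff.1 hab
    obtain ⟨s, hs, rfl⟩ := exists_restr_eq hb
    rw [dbar_restr, ← neg_add, neg_eq_zero, ← map_add] at h
    refine ⟨a + dbar ⊤ s, ⟨add_mem ha (dbar_mem_DbT11 hs), h⟩, -s, neg_mem hs, ?_⟩
    refine Prod.ext ?_ ?_
    · change dbar ⊤ (-s) = a - (a + dbar ⊤ s)
      rw [map_neg]
      abel
    · change -restr U (-s) = restr U s - 0
      rw [map_neg, neg_neg, sub_zero]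

theorem mem_cocycles_of_mem_OmegaT (hV : Module.finrank ℂ V = 1) {U : Opens V} {ω : Db10 U}
    (hω : ω ∈ OmegaT U) : ((0 : Db11 (⊤ : Opens V)), ω) ∈ cocycles U := by
  refine mem_cocycles_iff.2 ⟨⟨zero_mem _, hω.2⟩, ?_⟩
  rw [dbar_eq_zero_of_mem_Omega hV hω.1, map_zero, neg_zero, add_zero]

/-- Injectivity is Weyl's lemma on V. For surjectivity, let r extend b and solve ∂̄s = a + ∂̄r with
s tempered; then (a, b) - (0, s|_U) is the coboundary of s - r. -/
theorem exists_omegaEquiv (hV : Module.finrank ℂ V = 1) {U : Opens V}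
    (hU : IsCompact (U : Set V)ᶜ) :
    ∃ Φ : OmegaQuot U ≃ₗ[ℂ] LocalH1 U, ∀ (ω : Db10 U) (hω : ω ∈ OmegaT U),
      Φ (cls ω hω) = cls (0, ω) (mem_cocycles_of_mem_OmegaT hV hω) := by
  refine exists_subquotient_equiv (LinearMap.inr ℂ (Db11 (⊤ : Opens V)) (Db10 U))
    (fun ω hω => mem_cocycles_of_mem_OmegaT hV hω) ?_ ?_ ?_
  · rintro _ - ⟨η, hη, rfl⟩
    refine ⟨-η, neg_mem hη.2, Prod.ext ?_ ?_⟩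
    · change dbar ⊤ (-η) = 0
      rw [map_neg, dbar_eq_zero_of_mem_Omega hV hη.1, neg_zero]
    · change -restr U (-η) = restr U η
      rw [map_neg, neg_neg]
  · rintro ω - ⟨s, hs, h⟩
    have h1 : dbar ⊤ s = 0 := congrArg Prod.fst h
    have h2 : -restr U s = ω := congrArg Prod.snd h
    exact ⟨-s, ⟨neg_mem (mem_Omega_of_dbar_eq_zero hV h1), neg_mem hs⟩, by rw [map_neg, h2]⟩
  · rintro ⟨a, b⟩ hab
    obtain ⟨⟨ha, hb⟩, h⟩ := mem_cocycles_iff.1 hab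
    obtain ⟨r, hr, rfl⟩ := exists_restr_eq hb
    have h' := h
    rw [dbar_restr, ← neg_add, neg_eq_zero, ← map_add] at h'
    obtain ⟨s, hs, hsa⟩ := exists_dbar_eq hV hU (apply_eq_zero_of_restr_eq_zero h')
    refine ⟨restr U s, ⟨mem_Omega_of_dbar_eq_zero hV ?_, restr_mem_DbT10 hs⟩, s - r,
      sub_mem hs hr, Prod.ext ?_ ?_⟩
    · rw [dbar_restr, hsa, h']
    · change dbar ⊤ (s - r) = a - 0
      rw [map_sub, hsa, sub_zero, add_sub_cancel_right]
    · change -restr U (s - r) = restr U r - restr U s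
      rw [map_sub, neg_sub]

/-- Every extension of a tempered form from the complement of a compact set is tempered. -/
theorem mem_DbT10_of_restr_mem (hV : Module.finrank ℂ V = 1) {U : Opens V}
    (hU : IsCompact (U : Set V)ᶜ) {S : Db10 (⊤ : Opens V)} (hS : restr U S ∈ DbT10 U) :
    S ∈ DbT10 (⊤ : Opens V) := by
  obtain ⟨R, hR, h⟩ := exists_restr_eq hS
  have h1 : restr U (S - R) = 0 := by rw [map_sub, h, sub_self]
  have h2 := mem_DbT10_of_compact_support hV hU (apply_eq_zero_of_restr_eq_zero h1)
  rw [← sub_add_cancel S R]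
  exact add_mem h2 hR

end LocalCohomology

end TemperedForms

end

/-! ### The theorem -/

open TemperedForms in
theorem proposition7p1 {V : Type*} [NormedAddCommGroup V] [NormedSpace ℂ V]
    (hV : Module.finrank ℂ V = 1) (K : Set V) (hne : K.Nonempty) (hconv : Convex ℝ K)
    (hK : IsCompact K) (ε : ℝ) (hε : 0 < ε) (U : Opens V) (hU : U = complThickening hK ε) :
    (∀ η ∈ OmegaT (⊤ : Opens V), restr U η = 0 → η = 0) ∧
    ∃ (Ψ : GammaQuot U ≃ₗ[ℂ] LocalH1 U) (Φ : OmegaQuot U ≃ₗ[ℂ] LocalH1 U),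
      (∀ (T : Db11 (⊤ : Opens V)) (hT : T ∈ Gamma11 U),
        ∃ h : (T, (0 : Db10 U)) ∈ cocycles U, Ψ (cls T hT) = cls (T, 0) h) ∧
      (∀ (ω : Db10 U) (hω : ω ∈ OmegaT U),
        ∃ h : ((0 : Db11 (⊤ : Opens V)), ω) ∈ cocycles U, Φ (cls ω hω) = cls (0, ω) h) ∧
      (∀ (ω : Db10 U) (hω : ω ∈ OmegaT U) (S : Db10 (⊤ : Opens V)), restr U S = ω →
        ∃ h : dbar ⊤ S ∈ Gamma11 U, Φ (cls ω hω) = Ψ (cls (dbar ⊤ S) h)) := by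
  have : FiniteDimensional ℂ V := .of_finrank_pos (by omega)
  have : ProperSpace V := FiniteDimensional.proper ℂ V
  have : Nontrivial V := Module.nontrivial_of_finrank_pos (R := ℂ) (by omega)
  have hUc : IsCompact (U : Set V)ᶜ := by
    rw [hU]
    change IsCompact ((K + Metric.closedBall (0 : V) ε)ᶜ)ᶜ
    rw [compl_compl]
    exact hK.add (isCompact_closedBall 0 ε)
  -- The identity theorem needs a nonempty open set; V itself is not compact.
  have hUne : (U : Set V).Nonempty := by
    rw [Set.nonempty_iff_ne_empty]
    intro h
    rw [h, Set.compl_empty] at hUc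
    have : NoncompactSpace V := NormedSpace.noncompactSpace ℂ V
    exact noncompact_univ V hUc
  obtain ⟨Ψ, hΨ⟩ := exists_gammaEquiv U
  obtain ⟨Φ, hΦ⟩ := exists_omegaEquiv hV hUc
  refine ⟨fun η hη h => eq_zero_of_restr_eq_zero hV hUne hη.1 h, Ψ, Φ,
    fun T hT => ⟨_, hΨ T hT⟩, fun ω hω => ⟨_, hΦ ω hω⟩, ?_⟩
  rintro _ hω S rfl
  have hS := mem_DbT10_of_restr_mem hV hUc hω.2
  have hG : dbar ⊤ S ∈ Gamma11 U := by
    refine ⟨dbar_mem_DbT11 hS, ?_⟩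
    change restr U (dbar ⊤ S) = 0
    rw [← dbar_restr, dbar_eq_zero_of_mem_Omega hV hω.1]
  refine ⟨hG, ?_⟩
  rw [hΨ, hΦ, cls_eq_cls_iff]
  -- The coboundary of -S is (-∂̄S, S|_U), the difference of the two cocycles.
  refine ⟨-S, neg_mem hS, Prod.ext ?_ ?_⟩
  · change dbar ⊤ (-S) = 0 - dbar ⊤ S
    rw [map_neg, zero_sub]
  · change -restr U (-S) = restr U S - 0
    rw [map_neg, neg_neg, sub_zero]
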